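/- Let $T[1..n]$ be a text over the alphabet $\{1,\dots,\sigma\}$ ended by a terminator $T[n]=\$$ that occurs nowhere else and is smaller than all other symbols. Let $\mathit{SA}$ be the suffix array of $T$, $\mathit{ISA}$ its inverse, $\mathit{LCP}[i]$ the length of the longest common prefix of the suffixes $T[\mathit{SA}[i]..]$ and $T[\mathit{SA}[i-1]..]$ (with $\mathit{LCP}[1]=0$), and $r$ the number of maximal equal-symbol runs of the Burrows–Wheeler transform of $T$ ($\mathit{BWT}[i]=T[\mathit{SA}[i]-1]$, or $T[n]$ if $\mathit{SA}[i]=1$). A parse of $T$ is a partition of $T$ into non-empty phrases, each of which is either one explicit symbol or a substring $T[t..t+\ell-1]$ copied from an equal substring $T[s..s+\ell-1]$ with $s\neq t$ (they may overlap). It is a valid bidirectional scheme if, following the copies from any position, one always reaches an explicit symbol; $b$ is the least number of phrases of a valid bidirectional scheme of $T$. It is a lexicographic parse if, for every copied phrase and every $0\le j<\ell$, the suffix $T[s+j..]$ is lexicographically smaller than $T[t+j..]$. The lex-parse is obtained from left to right: if the next phrase starts at $t$, it has length $\ell=\mathit{LCP}[\mathit{ISA}[t]]$ and is copied from position $\mathit{SA}[\mathit{ISA}[t]-1]$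 if $\ell\ge 1$, and it is the explicit symbol $T[t]$ if $\ell=0$. Let $v$ be the number of its phrases. The lcpcomp factorization with threshold $\tau\ge1$ puts in a queue the indices $x$ with $\mathit{LCP}[x]\ge\tau$ and, while the largest current value $\mathit{LCP}'[x]$ in the queue is at least $\tau$, takes an index $x$ that attains it (ties broken arbitrarily), makes $T[\mathit{SA}[x]..\mathit{SA}[x]+\mathit{LCP}'[x]-1]$ a phrase copied from position $\mathit{SA}[x-1]$, removes from the queue the indices of the covered positions, and decreases $\mathit{LCP}'[\mathit{ISA}[q]]$ to $\min(\mathit{LCP}'[\mathit{ISA}[q]],\mathit{SA}[x]-q)$ for all $q<\mathit{SA}[x]$; $|\mathit{lcpcomp}|$ is the number of copied phrases plus the number of uncovered positions, each of which is an explicit symbol. Let $H_k=\frac1n\sum_{w}|T_w|\,H_0(T_w)$ be the $k$-th order empirical entropy of $T$, where $w$ ranges over strings of length $k$, $T_w$ is the string of the symbols that follow the occurrences of $w$ in $T$, and $H_0$ is the zeroth-order empirical entropy, in bits per symbol. Theorem. The lex-parse is a lexicographic parse of $T$, and no lexicographic parse of $T$ has fewer phrases. Moreover: 1. $v\le 2r$.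 2. $v\le|\mathit{lcpcomp}|$, for every threshold $\tau\ge 1$ and every way to break ties. 3. $v\le C\,b\,(1+\log_2(n/b))$ for an absolute constant $C$. 4. $v\log_2 n\le nH_k+o(n\log_2\sigma)$ whenever $\sigma\ge2$, $\log_\sigma n\to\infty$ and $k=o(\log_\sigma n)$, uniformly: for every $\varepsilon>0$ there is $\delta>0$ such that, for all $\sigma\ge 2$, all texts $T$ and all $k\ge0$ with $\max(1,k)\le\delta\log_\sigma n$, $v\log_2 n\le nH_k+\varepsilon\, n\log_2\sigma$. 5. $v\le C\,n/\log_\sigma n$ for an absolute constant $C$, all $\sigma\ge2$ and $n\ge2$. 6. There are a constant $c>0$ and an infinite family of texts of strictly increasing lengths, over a binary alphabet (plus the terminator), with $r\ge c\,v\log_2 n$. -/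

import Mathlib

namespace LexParse

/-! Strings are lists of natural numbers, positions are counted from `0`, and `T.drop i` is the
suffix of `T` that starts at position `i`.  The order `<` on `List ℕ` is the lexicographic order,
in which a proper prefix is smaller. -/

/-- `T` is a text over the alphabet `{1, …, σ}`, ended by the terminator `0`, which is smaller than
all the other symbols and occurs nowhere else. -/
def IsText (σ : ℕ) (T : List ℕ) : Prop :=
  ∃ S : List ℕ, T = S ++ [0] ∧ ∀ c ∈ S, 1 ≤ c ∧ c ≤ σ

/-- The symbol at position `i` (the default is used only outside of the text). -/
def sym (T : List ℕ) (i : ℕ) : ℕ := T.getD i 0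

/-! ### Suffix array, longest common prefixes, Burrows-Wheeler transform -/

/-- The suffix array as a list: the positions of `T`, sorted by their suffixes. -/
def suffixArray (T : List ℕ) : List ℕ :=
  (List.range T.length).mergeSort (fun i j => decide (T.drop i ≤ T.drop j))

/-- `SA T x` is the starting position of the suffix of rank `x` (ranks start at `0`). -/
def SA (T : List ℕ) (x : ℕ) : ℕ := (suffixArray T).getD x 0

/-- The inverse suffix array: `ISA T i` is the rank of the suffix that starts at position `i`. -/
def ISA (T : List ℕ) (i : ℕ) : ℕ := (suffixArray T).idxOf i

/-- The length of the longest common prefix of two strings. -/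
def commonPrefixLength : List ℕ → List ℕ → ℕ
  | a :: A, b :: B => if a = b then commonPrefixLength A B + 1 else 0
  | _, _ => 0

/-- The array of longest common prefixes of suffixes of consecutive ranks; it is `0` at rank `0`. -/
def LCP (T : List ℕ) (x : ℕ) : ℕ :=
  if x = 0 then 0 else commonPrefixLength (T.drop (SA T (x - 1))) (T.drop (SA T x))

/-- The Burrows-Wheeler transform: the symbol that precedes the suffix of rank `x`, cyclically. -/
def BWT (T : List ℕ) (x : ℕ) : ℕ :=
  if SA T x = 0 then sym T (T.length - 1) else sym T (SA T x - 1)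

/-- `r`: the number of maximal equal-symbol runs of the Burrows-Wheeler transform, counted by the
positions at which they start. -/
def bwtRuns (T : List ℕ) : ℕ :=
  ((Finset.range T.length).filter (fun x => x = 0 ∨ BWT T (x - 1) ≠ BWT T x)).card

/-! ### Parses -/

/-- A phrase `T[start .. start + len - 1]`, copied from the source that starts at `s` if
`src = some s`, and an explicit symbol if `src = none`. -/
structure Phrase where
  start : ℕ
  len : ℕ
  src : Option ℕ

/-- The phrases are non-empty and partition the interval of positions `[a, e)`, left to right. -/
def Tiles : List Phrase → ℕ → ℕ → Prop
  | [], a, e => a = e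
  | p :: ps, a, e => p.start = a ∧ 1 ≤ p.len ∧ Tiles ps (a + p.len) e

/-- An explicit phrase has length `1`; a copied phrase has a source inside of `T`, different from
the phrase and with the same content. -/
def Phrase.Correct (T : List ℕ) (p : Phrase) : Prop :=
  match p.src with
  | none => p.len = 1
  | some s => s ≠ p.start ∧ s + p.len ≤ T.length ∧
      ∀ j < p.len, sym T (s + j) = sym T (p.start + j)

/-- A partition of `T` into explicit symbols and phrases copied from other substrings of `T`. -/
def IsParse (T : List ℕ) (ps : List Phrase) : Prop :=
  Tiles ps 0 T.length ∧ ∀ p ∈ ps, p.Correct T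

/-- The function `f` of a parse, which maps each copied position to the position it is copied
from, and the position of an explicit symbol to `none`. -/
def copyMap (ps : List Phrase) (i : ℕ) : Option ℕ :=
  (ps.find? (fun p => decide (p.start ≤ i ∧ i < p.start + p.len))).bind
    (fun p => p.src.map (fun s => s + (i - p.start)))

/-- A valid bidirectional scheme: iterating `f` from any position ends at an explicit symbol. -/
def IsBidirectionalScheme (T : List ℕ) (ps : List Phrase) : Prop :=
  IsParse T ps ∧
    ∀ i < T.length, ∃ k : ℕ, (fun o : Option ℕ => o.bind (copyMap ps))^[k] (some i) = none

/-- `b`: the size of the smallest valid bidirectional scheme of `T`. -/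
noncomputable def bidirectionalSize (T : List ℕ) : ℕ :=
  sInf {m | ∃ ps, IsBidirectionalScheme T ps ∧ ps.length = m}

/-- An ordered parse with respect to a strict order `prec` on the suffixes (given by their
starting positions): every copied position has a source with a smaller suffix. -/
def IsOrderedParse (T : List ℕ) (prec : ℕ → ℕ → Prop) (ps : List Phrase) : Prop :=
  IsParse T ps ∧
    ∀ p ∈ ps, ∀ s, p.src = some s → ∀ j < p.len, prec (s + j) (p.start + j)

/-- A lexicographic parse: an ordered parse for the lexicographic order of the suffixes. -/
def IsLexicographicParse (T : List ℕ) (ps : List Phrase) : Prop :=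
  IsOrderedParse T (fun s t => T.drop s < T.drop t) ps

/-! ### The lex-parse -/

/-- The part of the lex-parse that starts at position `t`: the next phrase has length
`ℓ = LCP[ISA[t]]` and source `SA[ISA[t] - 1]`, or is an explicit symbol if `ℓ = 0`. -/
def lexParseFrom (T : List ℕ) (t : ℕ) : List Phrase :=
  if t < T.length then
    ⟨t, max 1 (LCP T (ISA T t)),
      if LCP T (ISA T t) = 0 then none else some (SA T (ISA T t - 1))⟩ ::
      lexParseFrom T (t + max 1 (LCP T (ISA T t)))
  else []
termination_by T.length - t
decreasing_by omega

/-- The lex-parse of `T`. -/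
def lexParse (T : List ℕ) : List Phrase := lexParseFrom T 0

/-- `v`: the number of phrases of the lex-parse. -/
def lexSize (T : List ℕ) : ℕ := (lexParse T).length

/-! ### The lcpcomp factorization -/

/-- The states `(queue, L, out)` that lcpcomp with threshold `t` can reach: `queue` holds the ranks
that may still start a factor, `L` the current values of the LCP array, `out` the factors reported
so far.  A step takes an entry `x` of the queue with the largest value (ties are broken
arbitrarily), reports the factor `T[SA[x] .. SA[x] + L[x] - 1]` with source `SA[x - 1]`, removes
from the queue all the entries whose position is covered by this factor, and decrements the values
of the preceding positions so that later factors end before it. -/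
inductive LcpcompReach (T : List ℕ) (t : ℕ) : Finset ℕ → (ℕ → ℕ) → List Phrase → Prop
  | init : LcpcompReach T t ((Finset.range T.length).filter (fun x => t ≤ LCP T x)) (LCP T) []
  | step (queue : Finset ℕ) (L : ℕ → ℕ) (out : List Phrase) (x : ℕ) :
      LcpcompReach T t queue L out → x ∈ queue → (∀ y ∈ queue, L y ≤ L x) → t ≤ L x →
      LcpcompReach T t
        (queue.filter (fun y => ¬ (SA T x ≤ SA T y ∧ SA T y < SA T x + L x)))
        (fun y => if SA T y < SA T x then min (L y) (SA T x - SA T y) else L y)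
        (⟨SA T x, L x, some (SA T (x - 1))⟩ :: out)

/-- `out` is the list of factors of a complete run of lcpcomp with threshold `t`: no entry of the
queue is left with a value of at least `t`. -/
def IsLcpcomp (T : List ℕ) (t : ℕ) (out : List Phrase) : Prop :=
  ∃ queue L, LcpcompReach T t queue L out ∧ ∀ y ∈ queue, L y < t

/-- The number of phrases of an lcpcomp factorization: its factors, and one explicit symbol for
each position that no factor covers. -/
def lcpcompSize (T : List ℕ) (out : List Phrase) : ℕ :=
  out.length +
    ((Finset.range T.length).filter
      (fun i => ∀ p ∈ out, ¬ (p.start ≤ i ∧ i < p.start + p.len))).card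

/-! ### Empirical entropy -/

/-- The zeroth-order empirical entropy of a string, per symbol, in bits (`0` if it is empty). -/
noncomputable def entropyZero (S : List ℕ) : ℝ :=
  ∑ c ∈ S.toFinset,
    ((S.count c : ℝ) / S.length) * Real.logb 2 ((S.length : ℝ) / S.count c)

/-- The symbols that follow the occurrences of `w` in `T`, in text order. -/
def following (T w : List ℕ) : List ℕ :=
  ((List.range (T.length - w.length)).filter
    (fun i => decide ((T.drop i).take w.length = w))).map (fun i => sym T (i + w.length))

/-- `H_k`: the `k`-th order empirical entropy of `T`, per symbol,
`(1 / n) * ∑ w, |T_w| * H_0 (T_w)`, where `w` runs over the strings of length `k` that occur in `T`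
followed by some symbol, and `T_w` is the string of the symbols that follow them. -/
noncomputable def entropy (T : List ℕ) (k : ℕ) : ℝ :=
  (1 / (T.length : ℝ)) *
    ∑ w ∈ (Finset.range (T.length - k)).image (fun i => (T.drop i).take k),
      ((following T w).length : ℝ) * entropyZero (following T w)

end LexParse

/-! One property of the suffix order drives the comparisons: if the suffix at `s` is smaller than
the one at `t` and they agree on `m` symbols, then `plcp T (t + j) ≥ m - j` for `j < m`
(`plcp_shift`). So a lex-parse phrase that starts inside a phrase copied from a smaller suffix
reaches at least the end of that phrase. As lex-parse phrases are disjoint, any set that meets every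
interval `[t, t + phraseLen T t)` has at least `v` elements (`lexSize_le_card`). The last positions
of the phrases of a lexicographic parse form such a set, and so do the last positions of the lcpcomp
factors with the uncovered positions. For the runs, `plcp` grows by at least one when moving one
position left from a position whose rank does not start a run (`IsText.plcp_pred`), so two positions
for each run start suffice.

The other upper bounds count windows. A window that holds a lex-parse phrase and the next symbol
starts the smallest suffix with that prefix, so its content determines its position
(`IsText.win_inj`). A bidirectional scheme of size `b` leaves at most `b * m` distinct windows of
length `m`, while nearly every phrase of length in `[Q, 2Q)` yields `Q` private windows of length
`4Q`; this allows `O(b)` phrases in each of `O(1 + log (n / b))` dyadic classes. Counting all words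
of length about `log_σ n / 4` gives `O(n / log_σ n)`. For the entropy, each phrase gets its
empirical probability given the preceding `k` symbols: the code lengths add up to at most `n * H_k`,
distinctness bounds the sum of the probabilities, and Gibbs' inequality (`card_mul_logb_card_le`)
compares the two.

For the lower bound on `r`, a binary shift register sequence of maximal period contains every
nonzero word of length `m` preceded by both symbols, so the transform changes inside the range of
each such word; thus `r` is linear in `n`, while `v = O(n / log n)`. -/

namespace LexParse

/-! ### Order of the suffixes -/

/-- The positions `s` and `t` agree on the next `m` symbols, all inside of `T`. -/
def Agree (T : List ℕ) (m s t : ℕ) : Prop :=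
  s + m ≤ T.length ∧ t + m ≤ T.length ∧ ∀ j < m, sym T (s + j) = sym T (t + j)

theorem drop_eq_sym_cons {T : List ℕ} {i : ℕ} (h : i < T.length) :
    T.drop i = sym T i :: T.drop (i + 1) := by
  rw [List.drop_eq_getElem_cons h, sym, List.getD_eq_getElem _ _ h]

theorem suffix_lt_iff {T : List ℕ} {s t : ℕ} (hs : s < T.length) (ht : t < T.length) :
    T.drop s < T.drop t ↔
      sym T s < sym T t ∨ sym T s = sym T t ∧ T.drop (s + 1) < T.drop (t + 1) := by
  rw [drop_eq_sym_cons hs, drop_eq_sym_cons ht, List.cons_lt_cons_iff]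

theorem Agree.mono {T : List ℕ} {m m' s t : ℕ} (h : Agree T m s t) (hm : m' ≤ m) :
    Agree T m' s t :=
  ⟨by have := h.1; omega, by have := h.2.1; omega, fun j hj => h.2.2 j (by omega)⟩

theorem Agree.shift {T : List ℕ} {m s t : ℕ} (h : Agree T m s t) {d : ℕ} (hd : d ≤ m) :
    Agree T (m - d) (s + d) (t + d) := by
  refine ⟨by have := h.1; omega, by have := h.2.1; omega, fun j hj => ?_⟩
  have := h.2.2 (d + j) (by omega)
  simpa only [Nat.add_assoc] using this

theorem agree_succ_iff {T : List ℕ} {m s t : ℕ} :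
    Agree T (m + 1) s t ↔
      s < T.length ∧ t < T.length ∧ sym T s = sym T t ∧ Agree T m (s + 1) (t + 1) := by
  constructor
  · intro h
    have h1 := h.1
    have h2 := h.2.1
    refine ⟨by omega, by omega, by simpa using h.2.2 0 (by omega), ?_⟩
    simpa using h.shift (d := 1) (by omega)
  · rintro ⟨hs, ht, h0, h1, h2, h3⟩
    refine ⟨by omega, by omega, fun j hj => ?_⟩
    rcases j with _ | j
    · simpa using h0
    · have := h3 j (by omega)
      rwa [show s + (j + 1) = s + 1 + j by omega, show t + (j + 1) = t + 1 + j by omega]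

theorem Agree.suffix_lt_iff {T : List ℕ} {m s t : ℕ} (h : Agree T m s t) :
    T.drop s < T.drop t ↔ T.drop (s + m) < T.drop (t + m) := by
  induction m generalizing s t with
  | zero => rfl
  | succ m ih =>
    obtain ⟨hs, ht, h0, h1⟩ := agree_succ_iff.1 h
    rw [LexParse.suffix_lt_iff hs ht, ih h1]
    simp only [h0, lt_irrefl, false_or, true_and]
    rw [show s + 1 + m = s + (m + 1) by omega, show t + 1 + m = t + (m + 1) by omega]

theorem suffix_lt_length {T : List ℕ} {s t : ℕ} (h : T.drop s < T.drop t) : t < T.length := by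
  by_contra hc
  rw [List.drop_of_length_le (l := T) (i := t) (by omega)] at h
  exact List.not_lt_nil _ h

theorem suffix_lt_trans {T : List ℕ} {s t u : ℕ} (h : T.drop s < T.drop t)
    (h' : T.drop t < T.drop u) : T.drop s < T.drop u := List.lt_trans h h'

theorem suffix_lt_irrefl {T : List ℕ} {s : ℕ} : ¬ T.drop s < T.drop s := List.lt_irrefl _

theorem suffix_lt_or {T : List ℕ} {s t : ℕ} (hs : s < T.length) (ht : t < T.length)
    (h : s ≠ t) : T.drop s < T.drop t ∨ T.drop t < T.drop s := by
  have hne : T.drop s ≠ T.drop t := fun e => by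
    have := congrArg List.length e
    simp at this
    omega
  exact lt_or_gt_of_ne hne

/-- The suffixes with a given prefix form an interval of the lexicographic order. -/
theorem Agree.between {T : List ℕ} {m s t u : ℕ} (h : Agree T m s t)
    (h1 : T.drop s < T.drop u) (h2 : T.drop u < T.drop t) : Agree T m u t := by
  induction m generalizing s t u with
  | zero => exact ⟨(suffix_lt_length h1).le, h.2.1, by simp⟩
  | succ m ih =>
    obtain ⟨hs, ht, h0, h3⟩ := agree_succ_iff.1 h
    have hu := suffix_lt_length h1
    rw [LexParse.suffix_lt_iff hs hu] at h1
    rw [LexParse.suffix_lt_iff hu ht] at h2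
    have e : sym T u = sym T t := by omega
    exact agree_succ_iff.2 ⟨hu, ht, e,
      ih h3 (h1.resolve_left (by omega)).2 (h2.resolve_left (by omega)).2⟩

theorem le_commonPrefixLength_iff {T : List ℕ} {m s t : ℕ} (hs : s ≤ T.length)
    (ht : t ≤ T.length) :
    m ≤ commonPrefixLength (T.drop s) (T.drop t) ↔ Agree T m s t := by
  induction m generalizing s t with
  | zero => simp [Agree, hs, ht]
  | succ m ih =>
    rw [agree_succ_iff]
    rcases hs.lt_or_eq with hs' | rfl
    · rcases ht.lt_or_eq with ht' | rfl
      · rw [← ih hs' ht', drop_eq_sym_cons hs', drop_eq_sym_cons ht', commonPrefixLength]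
        split_ifs with h <;> simp [h, hs', ht']
      · simp [commonPrefixLength]
    · simp [commonPrefixLength]

/-! ### Suffix array -/

theorem suffixArray_perm (T : List ℕ) : (suffixArray T).Perm (List.range T.length) :=
  List.mergeSort_perm _ _

theorem suffixArray_length (T : List ℕ) : (suffixArray T).length = T.length := by
  simpa using (suffixArray_perm T).length_eq

theorem suffixArray_nodup (T : List ℕ) : (suffixArray T).Nodup :=
  (suffixArray_perm T).nodup_iff.2 List.nodup_range

theorem mem_suffixArray {T : List ℕ} {i : ℕ} : i ∈ suffixArray T ↔ i < T.length := by
  rw [(suffixArray_perm T).mem_iff, List.mem_range]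

theorem SA_eq_getElem {T : List ℕ} {x : ℕ} (h : x < (suffixArray T).length) :
    SA T x = (suffixArray T)[x] := List.getD_eq_getElem _ _ h

theorem SA_lt {T : List ℕ} {x : ℕ} (h : x < T.length) : SA T x < T.length := by
  rw [← suffixArray_length T] at h
  rw [SA_eq_getElem h]
  exact mem_suffixArray.1 (List.getElem_mem h)

theorem ISA_lt {T : List ℕ} {i : ℕ} (h : i < T.length) : ISA T i < T.length := by
  rw [← suffixArray_length T]
  exact List.idxOf_lt_length_of_mem (mem_suffixArray.2 h)

theorem SA_ISA {T : List ℕ} {i : ℕ} (h : i < T.length) : SA T (ISA T i) = i := by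
  have h' : ISA T i < (suffixArray T).length := by
    rw [suffixArray_length]; exact ISA_lt h
  rw [SA_eq_getElem h']
  exact List.getElem_idxOf h'

theorem ISA_SA {T : List ℕ} {x : ℕ} (h : x < T.length) : ISA T (SA T x) = x := by
  rw [← suffixArray_length T] at h
  rw [SA_eq_getElem h]
  exact List.Nodup.idxOf_getElem (suffixArray_nodup T) x h

theorem SA_strictMono {T : List ℕ} {x y : ℕ} (hxy : x < y) (hy : y < T.length) :
    T.drop (SA T x) < T.drop (SA T y) := by
  have hy' : y < (suffixArray T).length := by rwa [suffixArray_length]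
  have hx' : x < (suffixArray T).length := by omega
  have hs : List.Pairwise (fun i j => decide (T.drop i ≤ T.drop j) = true) (suffixArray T) := by
    refine List.pairwise_mergeSort (fun a b c => ?_) (fun a b => ?_) _
    · simpa using fun h h' => le_trans h h'
    · simpa using le_total _ _
  have h1 := List.pairwise_iff_getElem.1 hs x y hx' hy' hxy
  rw [← SA_eq_getElem, ← SA_eq_getElem] at h1
  have h2 : SA T x ≠ SA T y := fun e => by
    have := congrArg (ISA T) e
    rw [ISA_SA (by omega), ISA_SA hy] at this
    omega
  rcases suffix_lt_or (SA_lt (hxy.trans hy)) (SA_lt hy) h2 with h | h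
  · exact h
  · exact absurd h (not_lt.2 (of_decide_eq_true h1))

theorem SA_lt_iff {T : List ℕ} {x y : ℕ} (hx : x < T.length) (hy : y < T.length) :
    T.drop (SA T x) < T.drop (SA T y) ↔ x < y := by
  refine ⟨fun h => ?_, fun h => SA_strictMono h hy⟩
  rcases lt_trichotomy x y with h' | rfl | h'
  · exact h'
  · exact absurd h suffix_lt_irrefl
  · exact absurd (suffix_lt_trans h (SA_strictMono h' hx)) suffix_lt_irrefl

theorem ISA_lt_iff {T : List ℕ} {s t : ℕ} (hs : s < T.length) (ht : t < T.length) :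
    ISA T s < ISA T t ↔ T.drop s < T.drop t := by
  rw [← SA_lt_iff (ISA_lt hs) (ISA_lt ht), SA_ISA hs, SA_ISA ht]

/-! ### The permuted array of longest common prefixes -/

/-- The length of the longest common prefix of the suffix at `t` with the preceding one. -/
def plcp (T : List ℕ) (t : ℕ) : ℕ := LCP T (ISA T t)

theorem LCP_eq_plcp {T : List ℕ} {x : ℕ} (h : x < T.length) : LCP T x = plcp T (SA T x) := by
  rw [plcp, ISA_SA h]

/-- The suffix at `t` has a predecessor, that agrees with it on `plcp T t` symbols. -/
theorem plcp_source {T : List ℕ} {t : ℕ} (ht : t < T.length) (h : ISA T t ≠ 0) :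
    SA T (ISA T t - 1) < T.length ∧ T.drop (SA T (ISA T t - 1)) < T.drop t ∧
      Agree T (plcp T t) (SA T (ISA T t - 1)) t := by
  have h1 := ISA_lt ht
  have h2 : SA T (ISA T t - 1) < T.length := SA_lt (by omega)
  refine ⟨h2, ?_, ?_⟩
  · have := SA_strictMono (T := T) (x := ISA T t - 1) (y := ISA T t) (by omega) h1
    rwa [SA_ISA ht] at this
  · rw [← le_commonPrefixLength_iff h2.le ht.le, plcp, LCP, if_neg h, SA_ISA ht]

theorem ISA_ne_zero_of_plcp {T : List ℕ} {t : ℕ} (h : plcp T t ≠ 0) : ISA T t ≠ 0 :=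
  fun e => h (by rw [plcp, LCP, if_pos e])

/-- The immediate predecessor of the suffix at `t` is either `s` or lies between `s` and `t`, so it
shares with `t` at least as much as `s` does. -/
theorem le_plcp {T : List ℕ} {m s t : ℕ} (hlt : T.drop s < T.drop t) (hs : s < T.length)
    (h : Agree T m s t) : m ≤ plcp T t := by
  have ht := suffix_lt_length hlt
  have hr := (ISA_lt_iff hs ht).2 hlt
  have h0 : ISA T t ≠ 0 := by omega
  obtain ⟨h1, h2, -⟩ := plcp_source ht h0
  have hag : Agree T m (SA T (ISA T t - 1)) t := by
    rcases eq_or_ne s (SA T (ISA T t - 1)) with e | e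
    · rwa [← e]
    · refine h.between ?_ h2
      rcases suffix_lt_or hs h1 e with h' | h'
      · exact h'
      · rw [← ISA_lt_iff h1 hs, ISA_SA (by have := ISA_lt ht; omega)] at h'
        omega
  rw [← le_commonPrefixLength_iff h1.le ht.le] at hag
  rwa [plcp, LCP, if_neg h0, SA_ISA ht]

/-- Cancelling `j` common symbols keeps the order, so `s + j` is a smaller suffix that agrees with
`t + j` on `m - j` symbols. -/
theorem plcp_shift {T : List ℕ} {s t m j : ℕ} (hlt : T.drop s < T.drop t)
    (h : Agree T m s t) (hj : j < m) : m ≤ j + plcp T (t + j) := by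
  have := le_plcp (((h.mono hj.le).suffix_lt_iff).1 hlt) (by have := h.1; omega)
    (h.shift hj.le)
  omega

theorem add_plcp_le {T : List ℕ} {t : ℕ} (ht : t < T.length) : t + plcp T t ≤ T.length := by
  by_cases h : ISA T t = 0
  · simp [plcp, LCP, h, ht.le]
  · exact (plcp_source ht h).2.2.2.1

theorem IsText.length_pos {σ : ℕ} {T : List ℕ} (hT : IsText σ T) : 0 < T.length := by
  obtain ⟨S, rfl, -⟩ := hT
  simp

theorem IsText.sym_le {σ : ℕ} {T : List ℕ} (hT : IsText σ T) (i : ℕ) : sym T i ≤ σ := by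
  obtain ⟨S, rfl, hS⟩ := hT
  rcases lt_trichotomy i S.length with h | h | h
  · rw [sym, List.getD_append _ _ _ _ h, List.getD_eq_getElem _ _ h]
    exact (hS _ (List.getElem_mem h)).2
  · simp [sym, h]
  · rw [sym, List.getD_eq_default _ _ (by simp; omega)]
    exact Nat.zero_le _

/-- An inequality, because the default value of `sym` beyond the text coincides with the terminator.
-/
theorem IsText.sym_eq_zero_iff {σ : ℕ} {T : List ℕ} (hT : IsText σ T) {i : ℕ} :
    sym T i = 0 ↔ T.length ≤ i + 1 := by
  obtain ⟨S, rfl, hS⟩ := hT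
  rcases lt_trichotomy i S.length with h | h | h
  · rw [sym, List.getD_append _ _ _ _ h, List.getD_eq_getElem _ _ h]
    have := (hS _ (List.getElem_mem h)).1
    simp
    omega
  · simp [sym, h]
  · rw [sym, List.getD_eq_default _ _ (by simp; omega)]
    simp
    omega

/-! ### The phrases of the lex-parse -/

/-- The length of the phrase that the lex-parse would start at `t`. -/
def phraseLen (T : List ℕ) (t : ℕ) : ℕ := max 1 (plcp T t)

theorem phraseLen_pos (T : List ℕ) (t : ℕ) : 1 ≤ phraseLen T t := le_max_left _ _

theorem plcp_le_phraseLen (T : List ℕ) (t : ℕ) : plcp T t ≤ phraseLen T t := le_max_right _ _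

theorem add_phraseLen_le {T : List ℕ} {t : ℕ} (ht : t < T.length) :
    t + phraseLen T t ≤ T.length := by
  have := add_plcp_le ht
  unfold phraseLen
  omega

theorem lexParseFrom_of_lt {T : List ℕ} {t : ℕ} (ht : t < T.length) :
    lexParseFrom T t = ⟨t, phraseLen T t,
      if plcp T t = 0 then none else some (SA T (ISA T t - 1))⟩ ::
        lexParseFrom T (t + phraseLen T t) := by
  rw [lexParseFrom, if_pos ht]
  rfl

theorem lexParseFrom_of_le {T : List ℕ} {t : ℕ} (ht : T.length ≤ t) :
    lexParseFrom T t = [] := by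
  rw [lexParseFrom, if_neg (by omega)]

theorem exists_starts_from (T : List ℕ) (t : ℕ) : ∃ P : Finset ℕ,
    P.card = (lexParseFrom T t).length ∧ (∀ i ∈ P, t ≤ i ∧ i < T.length) ∧
      ∀ i ∈ P, ∀ j ∈ P, i < j → i + phraseLen T i ≤ j := by
  rcases lt_or_ge t T.length with ht | ht
  · obtain ⟨P, h1, h2, h3⟩ := exists_starts_from T (t + phraseLen T t)
    have hp := phraseLen_pos T t
    refine ⟨insert t P, ?_, ?_, ?_⟩
    · rw [Finset.card_insert_of_notMem, h1, lexParseFrom_of_lt ht, List.length_cons]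
      intro h
      have := (h2 t h).1
      omega
    · intro i hi
      rcases Finset.mem_insert.1 hi with rfl | hi
      · exact ⟨le_rfl, ht⟩
      · have := h2 i hi
        omega
    · intro i hi j hj hij
      rcases Finset.mem_insert.1 hi with hi' | hi' <;>
        rcases Finset.mem_insert.1 hj with hj' | hj'
      · omega
      · exact hi' ▸ (h2 j hj').1
      · have := h2 i hi'
        omega
      · exact h3 i hi' j hj' hij
  · exact ⟨∅, by simp [lexParseFrom_of_le ht], by simp, by simp⟩
termination_by T.length - t
decreasing_by have := phraseLen_pos T t; omega

/-- The starting positions of the phrases of the lex-parse. -/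
theorem exists_starts (T : List ℕ) : ∃ P : Finset ℕ,
    P.card = lexSize T ∧ (∀ i ∈ P, i < T.length) ∧
      ∀ i ∈ P, ∀ j ∈ P, i < j → i + phraseLen T i ≤ j := by
  obtain ⟨P, h1, h2, h3⟩ := exists_starts_from T 0
  exact ⟨P, h1, fun i hi => (h2 i hi).2, h3⟩

/-- A set that meets all the possible phrases has at least `lexSize T` elements. -/
theorem lexSize_le_card {T : List ℕ} {S : Finset ℕ}
    (h : ∀ t < T.length, ∃ i ∈ S, t ≤ i ∧ i < t + phraseLen T t) : lexSize T ≤ S.card := by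
  obtain ⟨P, h1, h2, h3⟩ := exists_starts T
  choose! f hf using h
  rw [← h1]
  refine Finset.card_le_card_of_injOn f (fun t ht => (hf t (h2 t ht)).1) ?_
  intro i hi j hj hij
  have hfi := (hf i (h2 i hi)).2
  have hfj := (hf j (h2 j hj)).2
  rw [hij] at hfi
  rcases lt_trichotomy i j with h | h | h
  · have := h3 i hi j hj h
    omega
  · exact h
  · have := h3 j hj i hi h
    omega

/-! ### The lex-parse is an optimal lexicographic parse -/

theorem tiles_lexParseFrom {T : List ℕ} {t : ℕ} (ht : t ≤ T.length) :
    Tiles (lexParseFrom T t) t T.length := by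
  rcases ht.lt_or_eq with h | rfl
  · rw [lexParseFrom_of_lt h]
    exact ⟨rfl, phraseLen_pos T t, tiles_lexParseFrom (add_phraseLen_le h)⟩
  · rw [lexParseFrom_of_le le_rfl]
    rfl
termination_by T.length - t
decreasing_by have := phraseLen_pos T t; omega

theorem mem_lexParseFrom {T : List ℕ} {t : ℕ} {p : Phrase} (hp : p ∈ lexParseFrom T t) :
    p.start < T.length ∧ p.len = phraseLen T p.start ∧
      p.src = if plcp T p.start = 0 then none else some (SA T (ISA T p.start - 1)) := by
  rcases lt_or_ge t T.length with ht | ht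
  · rw [lexParseFrom_of_lt ht, List.mem_cons] at hp
    rcases hp with rfl | hp
    · exact ⟨ht, rfl, rfl⟩
    · exact mem_lexParseFrom hp
  · rw [lexParseFrom_of_le ht] at hp
    simp at hp
termination_by T.length - t
decreasing_by have := phraseLen_pos T t; omega

theorem lexParse_isLexicographicParse (T : List ℕ) :
    IsLexicographicParse T (lexParse T) := by
  have key : ∀ p ∈ lexParse T, p.src = none ∧ p.len = 1 ∨
      ∃ s, p.src = some s ∧ T.drop s < T.drop p.start ∧ Agree T p.len s p.start := by
    intro p hp
    obtain ⟨h1, h2, h3⟩ := mem_lexParseFrom hp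
    split_ifs at h3 with h0
    · exact Or.inl ⟨h3, by rw [h2, phraseLen, h0]; rfl⟩
    · obtain ⟨-, h5, h6⟩ := plcp_source h1 (ISA_ne_zero_of_plcp h0)
      refine Or.inr ⟨_, h3, h5, ?_⟩
      rwa [h2, phraseLen, max_eq_right (by omega)]
  refine ⟨⟨tiles_lexParseFrom (Nat.zero_le _), fun p hp => ?_⟩, fun p hp s hs j hj => ?_⟩
  · rcases key p hp with ⟨h1, h2⟩ | ⟨s, h1, h2, h3⟩
    · rw [Phrase.Correct, h1]
      exact h2
    · rw [Phrase.Correct, h1]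
      exact ⟨fun e => suffix_lt_irrefl (e ▸ h2), h3.1, h3.2.2⟩
  · rcases key p hp with ⟨h1, h2⟩ | ⟨s', h1, h2, h3⟩
    · simp [h1] at hs
    · obtain rfl : s' = s := by simpa [h1] using hs
      exact ((h3.mono hj.le).suffix_lt_iff).1 h2

/-- The last position of a phrase. -/
def Phrase.last (p : Phrase) : ℕ := p.start + p.len - 1

theorem Tiles.exists_mem {ps : List Phrase} {a e : ℕ} (h : Tiles ps a e) {i : ℕ} (ha : a ≤ i)
    (he : i < e) : ∃ p ∈ ps, p.start ≤ i ∧ i < p.start + p.len := by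
  induction ps generalizing a with
  | nil =>
    have : a = e := h
    omega
  | cons p ps ih =>
    obtain ⟨h1, h2, h3⟩ := h
    rcases lt_or_ge i (a + p.len) with h4 | h4
    · exact ⟨p, by simp, by omega, by omega⟩
    · obtain ⟨q, hq, h5⟩ := ih h3 h4
      exact ⟨q, by simp [hq], h5⟩

theorem Tiles.bounds {ps : List Phrase} {a e : ℕ} (h : Tiles ps a e) :
    a + ps.length ≤ e ∧ ∀ p ∈ ps, 1 ≤ p.len ∧ p.start + p.len ≤ e := by
  induction ps generalizing a with
  | nil =>
    have : a = e := h
    simp [this]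
  | cons p ps ih =>
    obtain ⟨h1, h2, h3⟩ := h
    obtain ⟨h4, h5⟩ := ih h3
    refine ⟨by rw [List.length_cons]; omega, fun q hq => ?_⟩
    rcases List.mem_cons.1 hq with rfl | hq
    · omega
    · exact h5 q hq

/-- The set to be met consists of the last positions of the phrases of `ps`: if `t` lies in a copied
phrase, `plcp_shift` applied to its source shows that the lex-parse phrase at `t` reaches the last
position. -/
theorem lexSize_le_of_isLexicographicParse {T : List ℕ} {ps : List Phrase}
    (h : IsLexicographicParse T ps) : (lexParse T).length ≤ ps.length := by
  obtain ⟨⟨hT, hc⟩, ho⟩ := h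
  refine (lexSize_le_card (S := (ps.map Phrase.last).toFinset) fun t ht => ?_).trans
    ((List.toFinset_card_le _).trans (by simp))
  obtain ⟨p, hp, h1, h2⟩ := hT.exists_mem (Nat.zero_le t) ht
  refine ⟨p.last, by simp only [List.mem_toFinset, List.mem_map]; exact ⟨p, hp, rfl⟩,
    by unfold Phrase.last; omega, ?_⟩
  have hb := (hT.bounds.2 p hp).2
  have hcp := hc p hp
  have hop := ho p hp
  have hpl := phraseLen_pos T t
  have hpl' := plcp_le_phraseLen T t
  unfold Phrase.last
  rcases hs : p.src with _ | s
  · rw [Phrase.Correct, hs] at hcp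
    have : p.len = 1 := hcp
    omega
  · rw [Phrase.Correct, hs] at hcp
    obtain ⟨-, h4, h5⟩ := hcp
    have hag : Agree T p.len s p.start := ⟨h4, hb, h5⟩
    have := plcp_shift (by simpa using hop s hs 0 (by omega)) hag
      (j := t - p.start) (by omega)
    rw [show p.start + (t - p.start) = t by omega] at this
    omega

/-! ### Comparison with lcpcomp -/

/-- The values only decrease, so no factor is longer than `plcp` at its start. Neither the greedy
choice nor the disjointness of the factors matters for the comparison. -/
theorem LcpcompReach.invariant {T : List ℕ} {τ : ℕ} (hτ : 1 ≤ τ) {queue : Finset ℕ} {L : ℕ → ℕ}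
    {out : List Phrase} (h : LcpcompReach T τ queue L out) :
    (∀ x ∈ queue, x < T.length) ∧ (∀ x, L x ≤ LCP T x) ∧
      ∀ p ∈ out, 1 ≤ p.len ∧ p.start < T.length ∧ p.len ≤ plcp T p.start := by
  induction h with
  | init => simp +contextual
  | step queue L out x _ hx _ hL ih =>
    obtain ⟨h1, h2, h3⟩ := ih
    refine ⟨fun y hy => h1 y (Finset.mem_filter.1 hy).1, fun y => ?_, fun p hp => ?_⟩
    · have := h2 y
      dsimp only
      split_ifs <;> omega
    · rcases List.mem_cons.1 hp with rfl | hp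
      · refine ⟨hτ.trans hL, SA_lt (h1 x hx), ?_⟩
        rw [← LCP_eq_plcp (h1 x hx)]
        exact h2 x
      · exact h3 p hp

theorem lexSize_le_lcpcompSize {T : List ℕ} {τ : ℕ} {out : List Phrase} (hτ : 1 ≤ τ)
    (h : IsLcpcomp T τ out) : lexSize T ≤ lcpcompSize T out := by
  obtain ⟨queue, L, hr, -⟩ := h
  have hinv := (hr.invariant hτ).2.2
  set U := (Finset.range T.length).filter
    (fun i => ∀ p ∈ out, ¬ (p.start ≤ i ∧ i < p.start + p.len)) with hU
  have hcard : ((out.map Phrase.last).toFinset ∪ U).card ≤ lcpcompSize T out :=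
    (Finset.card_union_le _ _).trans (Nat.add_le_add_right
      ((List.toFinset_card_le _).trans (by simp)) _)
  refine (lexSize_le_card fun t ht => ?_).trans hcard
  have hpl := phraseLen_pos T t
  have hpl' := plcp_le_phraseLen T t
  by_cases hc : ∃ p ∈ out, p.start ≤ t ∧ t < p.start + p.len
  · obtain ⟨p, hp, h1, h2⟩ := hc
    obtain ⟨h3, h4, h5⟩ := hinv p hp
    obtain ⟨-, h6, h7⟩ := plcp_source h4 (ISA_ne_zero_of_plcp (by omega))
    have := plcp_shift h6 (h7.mono h5) (j := t - p.start) (by omega)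
    rw [show p.start + (t - p.start) = t by omega] at this
    refine ⟨p.last, Finset.mem_union_left _ ?_, ?_⟩
    · simp only [List.mem_toFinset, List.mem_map]
      exact ⟨p, hp, rfl⟩
    · unfold Phrase.last
      omega
  · push Not at hc
    refine ⟨t, Finset.mem_union_right _ ?_, le_rfl, by omega⟩
    rw [hU, Finset.mem_filter, Finset.mem_range]
    exact ⟨ht, fun p hp h => by have := hc p hp h.1; omega⟩

/-! ### Comparison with the runs of the Burrows-Wheeler transform -/

/-- Equal preceding symbols extend the agreement of the two neighbouring suffixes by one symbol to
the left and keep their order. -/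
theorem IsText.plcp_pred {σ : ℕ} {T : List ℕ} (hT : IsText σ T) {t : ℕ} (ht : t < T.length)
    (h0 : ISA T t ≠ 0) (hB : BWT T (ISA T t - 1) = BWT T (ISA T t)) :
    1 ≤ t ∧ plcp T t + 1 ≤ plcp T (t - 1) := by
  obtain ⟨h1, h2, h3⟩ := plcp_source ht h0
  set s := SA T (ISA T t - 1) with hs
  have hne : s ≠ t := fun e => suffix_lt_irrefl (e ▸ h2)
  have hz : sym T (T.length - 1) = 0 := hT.sym_eq_zero_iff.2 (by omega)
  rw [BWT, BWT, SA_ISA ht, ← hs, hz] at hB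
  -- Position `0` is preceded cyclically by the terminator, which precedes no other position; so
  -- equal symbols exclude both `s = 0` and `t = 0`.
  have hs0 : s ≠ 0 := by
    intro e
    rw [if_pos e, if_neg (by omega)] at hB
    have := hT.sym_eq_zero_iff.1 hB.symm
    omega
  have ht0 : t ≠ 0 := by
    intro e
    rw [if_neg hs0, if_pos e] at hB
    have := hT.sym_eq_zero_iff.1 hB
    omega
  rw [if_neg hs0, if_neg ht0] at hB
  refine ⟨by omega, le_plcp (s := s - 1) ?_ (by omega) ?_⟩
  · rw [suffix_lt_iff (by omega) (by omega), hB, Nat.sub_add_cancel (by omega),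
      Nat.sub_add_cancel (by omega)]
    exact Or.inr ⟨rfl, h2⟩
  · refine agree_succ_iff.2 ⟨by omega, by omega, hB, ?_⟩
    rwa [Nat.sub_add_cancel (by omega), Nat.sub_add_cancel (by omega)]

theorem lexSize_le_two_mul_bwtRuns {σ : ℕ} {T : List ℕ} (hT : IsText σ T) :
    lexSize T ≤ 2 * bwtRuns T := by
  have hpos := hT.length_pos
  set A := ((Finset.range T.length).filter
    (fun x => x = 0 ∨ BWT T (x - 1) ≠ BWT T x)).image (SA T) with hA
  have hmem : ∀ t < T.length, t ∈ A ∨ 1 ≤ t ∧ plcp T t + 1 ≤ plcp T (t - 1) := by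
    intro t ht
    by_cases h0 : ISA T t ≠ 0 ∧ BWT T (ISA T t - 1) = BWT T (ISA T t)
    · exact Or.inr (hT.plcp_pred ht h0.1 h0.2)
    · refine Or.inl (Finset.mem_image.2 ⟨ISA T t, ?_, SA_ISA ht⟩)
      rw [Finset.mem_filter, Finset.mem_range]
      exact ⟨ISA_lt ht, by tauto⟩
  have h0A : 0 ∈ A := (hmem 0 hpos).resolve_right (by omega)
  have hchain : ∀ t m, t + m < T.length → (∀ i, t < i → i ≤ t + m → i ∉ A) →
      m ≤ plcp T t := by
    intro t m
    induction m generalizing t with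
    | zero => simp
    | succ m ih =>
      intro h1 h2
      have h3 := ih (t + 1) (by omega) (fun i hi hi' => h2 i (by omega) (by omega))
      have h4 := (hmem (t + 1) (by omega)).resolve_left (h2 _ (by omega) (by omega))
      rw [Nat.add_sub_cancel] at h4
      omega
  -- By `hchain`, some `a ∈ A` lies in `(t, t + plcp T t + 1]` unless the text ends first. Then the
  -- phrase at `t` contains `a - 1`, or `a - 2` when `a` is the right end of that interval and `plcp
  -- T t ≥ 1`. The element `0` of `A` stands for the end of the text.
  set S := A.image (fun a => if a = 0 then T.length - 1 else a - 1) ∪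
    A.image (fun a => if a = 0 then T.length - 2 else a - 2) with hS
  have hcard : S.card ≤ 2 * bwtRuns T := by
    have h1 : A.card ≤ bwtRuns T := Finset.card_image_le
    have h2 : S.card ≤ _ := Finset.card_union_le _ _
    have h3 := Finset.card_image_le (s := A)
      (f := fun a => if a = 0 then T.length - 1 else a - 1)
    have h4 := Finset.card_image_le (s := A)
      (f := fun a => if a = 0 then T.length - 2 else a - 2)
    omega
  refine (lexSize_le_card fun t ht => ?_).trans hcard
  have hpl := phraseLen_pos T t
  have hpl' := plcp_le_phraseLen T t
  have hpd : phraseLen T t = max 1 (plcp T t) := rfl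
  have hm1 : ∀ a ∈ A, (if a = 0 then T.length - 1 else a - 1) ∈ S := fun a ha =>
    Finset.mem_union_left _ (Finset.mem_image_of_mem _ ha)
  have hm2 : ∀ a ∈ A, (if a = 0 then T.length - 2 else a - 2) ∈ S := fun a ha =>
    Finset.mem_union_right _ (Finset.mem_image_of_mem _ ha)
  by_cases hc : ∃ a ∈ A, t < a ∧ a ≤ t + plcp T t + 1
  · obtain ⟨a, ha, h1, h2⟩ := hc
    have h3 := hm1 a ha
    have h4 := hm2 a ha
    rw [if_neg (by omega)] at h3 h4
    by_cases h5 : a - 1 < t + phraseLen T t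
    · exact ⟨a - 1, h3, by omega, h5⟩
    · exact ⟨a - 2, h4, by omega, by omega⟩
  · push Not at hc
    have hend : T.length ≤ t + plcp T t + 1 := by
      by_contra hlt
      have := hchain t (plcp T t + 1) (by omega) fun i hi hi' hiA => by
        have := hc i hiA hi
        omega
      omega
    have h3 := hm1 0 h0A
    have h4 := hm2 0 h0A
    rw [if_pos rfl] at h3 h4
    by_cases h5 : T.length - 1 < t + phraseLen T t
    · exact ⟨_, h3, by omega, h5⟩
    · exact ⟨_, h4, by omega, by omega⟩

/-! ### Windows -/

/-- The `m` symbols that start at position `u`, padded by zeros. -/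
def win (T : List ℕ) (m u : ℕ) : List ℕ := (List.range m).map fun j => sym T (u + j)

theorem win_eq_iff {T : List ℕ} {m u u' : ℕ} :
    win T m u = win T m u' ↔ ∀ j < m, sym T (u + j) = sym T (u' + j) := by
  simp [win, List.map_inj_left]

/-- The first zero of a window that overruns the text is the terminator, and its offset determines
where the window starts. -/
theorem IsText.add_le_of_win_eq {σ : ℕ} {T : List ℕ} (hT : IsText σ T) {m s u : ℕ}
    (hs : s < T.length) (hu : u < T.length) (hne : s ≠ u) (h : win T m s = win T m u) :
    s + m ≤ T.length := by
  by_contra hc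
  rw [win_eq_iff] at h
  have h1 := h (T.length - 1 - s) (by omega)
  rw [hT.sym_eq_zero_iff.2 (by omega), eq_comm, hT.sym_eq_zero_iff] at h1
  have h2 := h (T.length - 1 - u) (by omega)
  rw [hT.sym_eq_zero_iff.2 (show T.length ≤ u + (T.length - 1 - u) + 1 by omega),
    hT.sym_eq_zero_iff] at h2
  omega

theorem IsText.agree_of_win_eq {σ : ℕ} {T : List ℕ} (hT : IsText σ T) {m s u : ℕ}
    (hs : s < T.length) (hu : u < T.length) (hne : s ≠ u) (h : win T m s = win T m u) :
    Agree T m s u :=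
  ⟨hT.add_le_of_win_eq hs hu hne h, hT.add_le_of_win_eq hu hs hne.symm h.symm, win_eq_iff.1 h⟩

/-- A window that contains a phrase of the lex-parse and the symbol that follows it starts the
smallest suffix among those that start with the same window. -/
theorem IsText.not_lt_of_win_eq {σ : ℕ} {T : List ℕ} (hT : IsText σ T) {m s u t : ℕ}
    (hut : u ≤ t) (ht : t < T.length) (htm : t + plcp T t < u + m) (hs : s < T.length)
    (h : win T m s = win T m u) : ¬ T.drop s < T.drop u := by
  intro hlt
  have hne : s ≠ u := fun e => suffix_lt_irrefl (e ▸ hlt)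
  have := plcp_shift hlt (hT.agree_of_win_eq hs (by omega) hne h) (j := t - u) (by omega)
  rw [show u + (t - u) = t by omega] at this
  omega

theorem IsText.win_inj {σ : ℕ} {T : List ℕ} (hT : IsText σ T) {m u t u' t' : ℕ}
    (hut : u ≤ t) (ht : t < T.length) (htm : t + plcp T t < u + m)
    (hut' : u' ≤ t') (ht' : t' < T.length) (htm' : t' + plcp T t' < u' + m)
    (h : win T m u = win T m u') : u = u' := by
  by_contra hne
  rcases suffix_lt_or (T := T) (by omega) (by omega) hne with h' | h'
  · exact hT.not_lt_of_win_eq hut' ht' htm' (by omega) h h'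
  · exact hT.not_lt_of_win_eq hut ht htm (by omega) h.symm h'

/-- The distinct windows of length `m`. -/
def windows (T : List ℕ) (m : ℕ) : Finset (List ℕ) := (Finset.range T.length).image (win T m)

theorem copyMap_eq {T : List ℕ} {ps : List Phrase} (h : Tiles ps 0 T.length) {u : ℕ}
    (hu : u < T.length) : ∃ p ∈ ps, p.start ≤ u ∧ u < p.start + p.len ∧
      copyMap ps u = p.src.map (fun s => s + (u - p.start)) := by
  rcases hf : ps.find? (fun p => decide (p.start ≤ u ∧ u < p.start + p.len)) with _ | p
  · obtain ⟨p, hp, h1⟩ := h.exists_mem (Nat.zero_le u) hu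
    have := List.find?_eq_none.1 hf p hp
    simp [h1] at this
  · have h1 := List.find?_some hf
    have h2 := List.mem_of_find?_eq_some hf
    rw [decide_eq_true_eq] at h1
    exact ⟨p, h2, h1.1, h1.2, by rw [copyMap, hf]; rfl⟩

/-- As long as the window misses the last position of the phrase that contains its start, it lies
inside a copied phrase and can be replaced by its source. Validity of the scheme bounds the number
of replacements, hence the induction on `k`. -/
theorem IsBidirectionalScheme.exists_win_eq {T : List ℕ} {ps : List Phrase}
    (h : IsBidirectionalScheme T ps) {m u : ℕ} (hm : 1 ≤ m) (hu : u < T.length) :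
    ∃ p ∈ ps, ∃ u', u' ≤ p.last ∧ p.last < u' + m ∧ win T m u' = win T m u := by
  obtain ⟨⟨hT, hc⟩, hk⟩ := h
  obtain ⟨k, hk⟩ := hk u hu
  induction k generalizing u with
  | zero => simp at hk
  | succ k ih =>
    obtain ⟨p, hp, h1, h2, h3⟩ := copyMap_eq hT hu
    by_cases hl : p.last < u + m
    · exact ⟨p, hp, u, by unfold Phrase.last; omega, hl, rfl⟩
    have hcp := hc p hp
    unfold Phrase.last at hl
    rw [Phrase.Correct] at hcp
    rcases hs : p.src with _ | s
    · rw [hs] at hcp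
      have : p.len = 1 := hcp
      omega
    · rw [hs] at hcp h3
      obtain ⟨-, h4, h5⟩ := hcp
      rw [Function.iterate_succ_apply] at hk
      obtain ⟨q, hq, u', h6, h7, h8⟩ :=
        ih (u := s + (u - p.start)) (by omega) (by rw [← hk]; exact congrArg _ h3.symm)
      refine ⟨q, hq, u', h6, h7, h8.trans (win_eq_iff.2 fun j hj => ?_)⟩
      have := h5 (u - p.start + j) (by omega)
      rwa [← Nat.add_assoc, ← Nat.add_assoc, show p.start + (u - p.start) = u by omega] at this

/-- A window is determined by a phrase whose last position one of its occurrences contains, and by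
the offset, below `m`, of that position. -/
theorem IsBidirectionalScheme.card_windows_le {T : List ℕ} {ps : List Phrase}
    (h : IsBidirectionalScheme T ps) {m : ℕ} (hm : 1 ≤ m) :
    (windows T m).card ≤ ps.length * m := by
  have hsub : windows T m ⊆ ((ps.map Phrase.last).toFinset ×ˢ Finset.range m).image
      (fun x => win T m (x.1 - x.2)) := by
    intro w hw
    obtain ⟨u, hu, rfl⟩ := Finset.mem_image.1 hw
    obtain ⟨p, hp, u', h1, h2, h3⟩ := h.exists_win_eq hm (Finset.mem_range.1 hu)
    refine Finset.mem_image.2 ⟨(p.last, p.last - u'), ?_, ?_⟩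
    · simp only [Finset.mem_product, List.mem_toFinset, List.mem_map, Finset.mem_range]
      exact ⟨⟨p, hp, rfl⟩, by omega⟩
    · dsimp only
      rw [← h3, show p.last - (p.last - u') = u' by omega]
  refine (Finset.card_le_card hsub).trans (Finset.card_image_le.trans ?_)
  rw [Finset.card_product, Finset.card_range]
  exact Nat.mul_le_mul_right _ ((List.toFinset_card_le _).trans (by simp))

/-! ### Counting phrases by their lengths -/

theorem card_long_mul_le {T : List ℕ} {P : Finset ℕ} (hP : ∀ i ∈ P, i < T.length)
    (hsep : ∀ i ∈ P, ∀ j ∈ P, i < j → i + phraseLen T i ≤ j) (L : ℕ) :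
    (P.filter fun t => L ≤ phraseLen T t).card * L ≤ T.length := by
  have := Finset.card_le_card_of_injOn
    (s := (P.filter fun t => L ≤ phraseLen T t) ×ˢ Finset.range L)
    (t := Finset.range T.length) (fun x => x.1 + x.2) ?_ ?_
  · simpa using this
  · rintro ⟨t, i⟩ hx
    simp only [Finset.coe_product, Finset.coe_filter, Finset.coe_range, Set.mem_prod,
      Set.mem_ofPred_eq, Set.mem_Iio] at hx ⊢
    have := add_phraseLen_le (hP t hx.1.1)
    omega
  · rintro ⟨t, i⟩ hx ⟨t', i'⟩ hx' heq
    simp only [Finset.coe_product, Finset.coe_filter, Finset.coe_range, Set.mem_prod,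
      Set.mem_ofPred_eq, Set.mem_Iio] at hx hx' heq
    have h1 := hsep t hx.1.1 t' hx'.1.1
    have h2 := hsep t' hx'.1.1 t hx.1.1
    have : t = t' := by omega
    ext <;> dsimp only <;> omega

/-- For a phrase at `t`, the windows of length `4 * Q` that start at `t - i`, `i < Q`, all contain
the phrase and the next symbol. Starts in the class are at least `Q` apart, so all these windows
differ, and there are at most `4 * Q * b` of them. -/
theorem IsText.card_class_le {σ : ℕ} {T : List ℕ} (hT : IsText σ T) {P : Finset ℕ}
    (hP : ∀ i ∈ P, i < T.length)
    (hsep : ∀ i ∈ P, ∀ j ∈ P, i < j → i + phraseLen T i ≤ j) {b : ℕ}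
    (hb : ∀ m, 1 ≤ m → (windows T m).card ≤ b * m) {Q : ℕ} (hQ : 1 ≤ Q) :
    (P.filter fun t => Q ≤ phraseLen T t ∧ phraseLen T t < 2 * Q).card ≤ 4 * b + 1 := by
  set R := P.filter fun t => Q ≤ phraseLen T t ∧ phraseLen T t < 2 * Q with hR
  have hRm : ∀ t ∈ R, t ∈ P ∧ Q ≤ phraseLen T t ∧ phraseLen T t < 2 * Q := fun t ht =>
    Finset.mem_filter.1 ht
  -- A start too close to `0` for the subtraction `t - i`; two such starts would be less than `Q`
  -- apart.
  have h1 : (R.filter fun t => ¬ Q ≤ t + 1).card ≤ 1 := by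
    rw [Finset.card_le_one]
    intro i hi j hj
    rw [Finset.mem_filter] at hi hj
    have h1 := hRm i hi.1
    have h2 := hRm j hj.1
    have h3 := hsep i h1.1 j h2.1
    have h4 := hsep j h2.1 i h1.1
    omega
  have h2 : (R.filter fun t => Q ≤ t + 1).card * Q ≤ (4 * b) * Q := by
    have := Finset.card_le_card_of_injOn
      (s := (R.filter fun t => Q ≤ t + 1) ×ˢ Finset.range Q)
      (t := windows T (4 * Q)) (fun x => win T (4 * Q) (x.1 - x.2)) ?_ ?_
    · have h3 := hb (4 * Q) (by omega)
      rw [Finset.card_product, Finset.card_range] at this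
      calc _ ≤ _ := this
        _ ≤ _ := h3
        _ = _ := by ring
    · rintro ⟨t, i⟩ hx
      simp only [Finset.coe_product, Finset.coe_filter, Finset.coe_range, Set.mem_prod,
        Set.mem_ofPred_eq, Set.mem_Iio] at hx
      have := hP t (hRm t hx.1.1).1
      exact Finset.mem_image_of_mem _ (Finset.mem_range.2 (by dsimp only; omega))
    · rintro ⟨t, i⟩ hx ⟨t', i'⟩ hx' heq
      simp only [Finset.coe_product, Finset.coe_filter, Finset.coe_range, Set.mem_prod,
        Set.mem_ofPred_eq, Set.mem_Iio] at hx hx' heq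
      have h1 := hRm t hx.1.1
      have h2 := hRm t' hx'.1.1
      have h3 := hsep t h1.1 t' h2.1
      have h4 := hsep t' h2.1 t h1.1
      have h5 := plcp_le_phraseLen T t
      have h6 := plcp_le_phraseLen T t'
      have h7 := hT.win_inj (t := t) (t' := t') (by omega) (hP t h1.1) (by omega) (by omega)
        (hP t' h2.1) (by omega) heq
      ext <;> dsimp only <;> omega
  have h3 := Nat.le_of_mul_le_mul_right h2 hQ
  have h4 := Finset.card_filter_add_card_filter_not (s := R) (fun t => Q ≤ t + 1)
  omega

theorem IsText.lexSize_le_of_card_windows {σ : ℕ} {T : List ℕ} (hT : IsText σ T) {b : ℕ}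
    (hb : ∀ m, 1 ≤ m → (windows T m).card ≤ b * m) {K : ℕ} (hK : T.length ≤ b * 2 ^ K) :
    lexSize T ≤ K * (4 * b + 1) + b := by
  obtain ⟨P, hc, hP, hsep⟩ := exists_starts T
  have hsub : P ⊆ (Finset.range K).biUnion
      (fun k => P.filter fun t => 2 ^ k ≤ phraseLen T t ∧ phraseLen T t < 2 * 2 ^ k) ∪
      P.filter fun t => 2 ^ K ≤ phraseLen T t := by
    intro t ht
    rw [Finset.mem_union, Finset.mem_biUnion, Finset.mem_filter]
    by_cases hl : 2 ^ K ≤ phraseLen T t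
    · exact Or.inr ⟨ht, hl⟩
    · have hne : phraseLen T t ≠ 0 := by have := phraseLen_pos T t; omega
      refine Or.inl ⟨Nat.log 2 (phraseLen T t), ?_, ?_⟩
      · rw [Finset.mem_range]
        exact Nat.log_lt_of_lt_pow hne (by omega)
      · rw [Finset.mem_filter]
        refine ⟨ht, Nat.pow_log_le_self 2 hne, ?_⟩
        have := Nat.lt_pow_succ_log_self (b := 2) (by norm_num) (phraseLen T t)
        rwa [pow_succ, mul_comm] at this
  have h1 : (P.filter fun t => 2 ^ K ≤ phraseLen T t).card ≤ b :=
    Nat.le_of_mul_le_mul_right ((card_long_mul_le hP hsep (2 ^ K)).trans hK) (by positivity)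
  have h2 : ((Finset.range K).biUnion
      (fun k => P.filter fun t => 2 ^ k ≤ phraseLen T t ∧ phraseLen T t < 2 * 2 ^ k)).card ≤
      K * (4 * b + 1) := by
    refine (Finset.card_biUnion_le_card_mul _ _ (4 * b + 1) fun k _ =>
      hT.card_class_le hP hsep hb Nat.one_le_two_pow).trans (by simp)
  rw [← hc]
  exact (Finset.card_le_card hsub).trans ((Finset.card_union_le _ _).trans (by omega))

/-- The scheme of explicit symbols only; it makes the infimum in `bidirectionalSize` an attained
one. -/
theorem exists_isBidirectionalScheme (T : List ℕ) : ∃ ps, IsBidirectionalScheme T ps := by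
  have ht : ∀ m a, Tiles ((List.range' a m).map fun i => (⟨i, 1, none⟩ : Phrase)) a (a + m) := by
    intro m
    induction m with
    | zero => exact fun a => rfl
    | succ m ih =>
      intro a
      have := ih (a + 1)
      rw [show a + 1 + m = a + (m + 1) by omega] at this
      exact ⟨rfl, le_rfl, this⟩
  have ht0 := ht T.length 0
  rw [Nat.zero_add] at ht0
  refine ⟨_, ⟨ht0, fun p hp => ?_⟩, fun i hi => ⟨1, ?_⟩⟩
  · obtain ⟨i, -, rfl⟩ := List.mem_map.1 hp
    exact rfl
  · obtain ⟨p, hp, -, -, h1⟩ := copyMap_eq ht0 hi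
    obtain ⟨j, -, rfl⟩ := List.mem_map.1 hp
    simpa using h1

theorem exists_bidirectionalSize (T : List ℕ) :
    ∃ ps, IsBidirectionalScheme T ps ∧ ps.length = bidirectionalSize T := by
  obtain ⟨ps, hps⟩ := exists_isBidirectionalScheme T
  exact Nat.sInf_mem (s := {m | ∃ ps, IsBidirectionalScheme T ps ∧ ps.length = m})
    ⟨_, ps, hps, rfl⟩

theorem IsText.lexSize_le_bidirectionalSize {σ : ℕ} {T : List ℕ} (hT : IsText σ T) :
    (lexSize T : ℝ) ≤ 6 * ((bidirectionalSize T : ℝ) *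
      (1 + Real.logb 2 ((T.length : ℝ) / (bidirectionalSize T : ℝ)))) := by
  obtain ⟨ps, hps, hb⟩ := exists_bidirectionalSize T
  have hw := fun m hm => hps.card_windows_le (m := m) hm
  have hle := hps.1.1.bounds.1
  rw [hb] at hw hle
  have hpos := hT.length_pos
  have hb1 : 1 ≤ bidirectionalSize T := by
    rw [← hb]
    rcases ps with _ | ⟨p, ps⟩
    · have : 0 = T.length := hps.1.1
      omega
    · simp
  generalize bidirectionalSize T = b at *
  have hb1' : (1 : ℝ) ≤ b := by exact_mod_cast hb1
  have hle' : (b : ℝ) ≤ T.length := by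
    exact_mod_cast (show b ≤ T.length by omega)
  set x := Real.logb 2 ((T.length : ℝ) / (b : ℝ)) with hx
  have hx0 : 0 ≤ x := Real.logb_nonneg (by norm_num) (by rwa [le_div_iff₀ (by positivity), one_mul])
  have hK1 := Nat.le_ceil x
  have hK2 := Nat.ceil_lt_add_one hx0
  -- With `K = ⌈log₂ (n / b)⌉`, the phrases of length at least `2 ^ K` number at most `b`. The
  -- constant is `6 = 5 + 1`, from `4 * b + 1 ≤ 5 * b` in each class and this last `b`.
  generalize ⌈x⌉₊ = K at *
  have hK : T.length ≤ b * 2 ^ K := by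
    rw [hx, Real.logb_le_iff_le_rpow (by norm_num) (by positivity), Real.rpow_natCast,
      div_le_iff₀ (by positivity)] at hK1
    rw [mul_comm]
    exact_mod_cast hK1
  have h := hT.lexSize_le_of_card_windows hw hK
  have h' : (lexSize T : ℝ) ≤ K * (4 * b + 1) + b := by exact_mod_cast h
  have h2 : (K : ℝ) * (4 * b + 1) ≤ (x + 1) * (5 * b) := by
    apply mul_le_mul hK2.le (by linarith) (by positivity) (by positivity)
  nlinarith

/-! ### Words -/

/-- The words of length `m` over the alphabet `{0, …, a - 1}`. -/
def words (a : ℕ) : ℕ → Finset (List ℕ)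
  | 0 => {[]}
  | m + 1 => (Finset.range a ×ˢ words a m).map
      ⟨fun x => x.1 :: x.2, fun x y h => by
        rw [List.cons.injEq] at h
        exact Prod.ext h.1 h.2⟩

theorem mem_words {a m : ℕ} {Y : List ℕ} : Y ∈ words a m ↔ Y.length = m ∧ ∀ c ∈ Y, c < a := by
  induction m generalizing Y with
  | zero => simp +contextual [words]
  | succ m ih =>
    rcases Y with _ | ⟨c, Y⟩
    · simp [words]
    · simp only [words, Finset.mem_map, Finset.mem_product, Finset.mem_range, ih, Prod.exists,
        List.length_cons, List.mem_cons, forall_eq_or_imp, Nat.add_right_cancel_iff]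
      constructor
      · rintro ⟨d, Z, ⟨h1, h2, h3⟩, he⟩
        obtain ⟨rfl, rfl⟩ := List.cons.inj he
        exact ⟨h2, h1, h3⟩
      · rintro ⟨h1, h2, h3⟩
        exact ⟨c, Y, ⟨h2, h1, h3⟩, rfl⟩

theorem card_words (a m : ℕ) : (words a m).card = a ^ m := by
  induction m with
  | zero => simp [words]
  | succ m ih => rw [words, Finset.card_map, Finset.card_product, ih, Finset.card_range, pow_succ']

theorem IsText.win_mem_words {σ : ℕ} {T : List ℕ} (hT : IsText σ T) (m u : ℕ) :
    win T m u ∈ words (σ + 1) m := by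
  rw [mem_words]
  refine ⟨by simp [win], fun c hc => ?_⟩
  obtain ⟨j, -, rfl⟩ := List.mem_map.1 hc
  exact Nat.lt_succ_of_le (hT.sym_le _)

/-- A phrase shorter than `L` is determined by the window of length `L` at its start, a word over `σ
+ 1` symbols; longer phrases are few because they are disjoint. -/
theorem IsText.lexSize_mul_le {σ : ℕ} {T : List ℕ} (hT : IsText σ T) (L : ℕ) :
    lexSize T * L ≤ T.length + (σ + 1) ^ L * L := by
  obtain ⟨P, hc, hP, hsep⟩ := exists_starts T
  have h1 := card_long_mul_le hP hsep L
  have h2 : (P.filter fun t => ¬ L ≤ phraseLen T t).card ≤ (σ + 1) ^ L := by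
    rw [← card_words]
    refine Finset.card_le_card_of_injOn (win T L) (fun t _ => hT.win_mem_words L t) ?_
    intro t ht t' ht' heq
    rw [Finset.mem_coe, Finset.mem_filter] at ht ht'
    have h5 := plcp_le_phraseLen T t
    have h6 := plcp_le_phraseLen T t'
    exact hT.win_inj le_rfl (hP t ht.1) (by omega) le_rfl (hP t' ht'.1) (by omega) heq
  rw [← hc, ← Finset.card_filter_add_card_filter_not (s := P) (fun t => L ≤ phraseLen T t),
    add_mul]
  exact Nat.add_le_add h1 (Nat.mul_le_mul_right _ h2)

theorem logb_two_le_two_mul_sqrt {x : ℝ} (hx : 0 < x) : Real.logb 2 x ≤ 2 * √x := by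
  have hs := Real.sqrt_pos.2 hx
  have h1 : Real.log (√x / 2) ≤ √x / 2 - 1 := Real.log_le_sub_one_of_pos (by positivity)
  rw [Real.log_div hs.ne' (by norm_num), Real.log_sqrt hx.le] at h1
  have h2 := Real.log_two_gt_d9
  have h3 := Real.log_two_lt_d9
  rw [Real.logb, div_le_iff₀ (by linarith)]
  nlinarith

theorem lexSize_le_length (T : List ℕ) : lexSize T ≤ T.length := by
  have := (tiles_lexParseFrom (T := T) (Nat.zero_le _)).bounds.1
  rw [lexSize, lexParse]
  omega

theorem logb_le_logb_two {σ : ℕ} (hσ : 2 ≤ σ) {x : ℝ} (hx : 1 ≤ x) :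
    Real.logb σ x ≤ Real.logb 2 x := by
  have hσ' : (2 : ℝ) ≤ σ := by exact_mod_cast hσ
  exact div_le_div_of_nonneg_left (Real.log_nonneg hx) (Real.log_pos (by norm_num))
    (Real.log_le_log (by norm_num) hσ')

theorem IsText.lexSize_le_div_logb {σ : ℕ} {T : List ℕ} (hσ : 2 ≤ σ) (hT : IsText σ T)
    (hn : 2 ≤ T.length) :
    (lexSize T : ℝ) ≤ 10 * ((T.length : ℝ) / Real.logb (σ : ℝ) (T.length : ℝ)) := by
  have hσ' : (2 : ℝ) ≤ σ := by exact_mod_cast hσ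
  have hn' : (2 : ℝ) ≤ T.length := by exact_mod_cast hn
  have hle : (lexSize T : ℝ) ≤ T.length := by exact_mod_cast lexSize_le_length T
  have hlog2 : Real.logb σ T.length ≤ 2 * √(T.length : ℝ) :=
    (logb_le_logb_two hσ (by linarith)).trans (logb_two_le_two_mul_sqrt (by linarith))
  have hl0 : 0 < Real.logb σ T.length := Real.logb_pos (by linarith) (by linarith)
  have hpow : (σ : ℝ) ^ Real.logb σ T.length = T.length :=
    Real.rpow_logb (by linarith) (by linarith) (by linarith)
  have hsq := Real.sq_sqrt (show (0 : ℝ) ≤ T.length by linarith)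
  have hs0 := Real.sqrt_pos.2 (show (0 : ℝ) < T.length by linarith)
  have hmul := hT.lexSize_mul_le
  generalize Real.logb (σ : ℝ) (T.length : ℝ) = x at *
  rw [← mul_div_assoc, le_div_iff₀ hl0]
  -- Below `4` the trivial `v ≤ n` suffices. Otherwise `L = ⌊x / 4⌋ ≥ 1` gives `(σ + 1) ^ L ≤ σ ^ (2
  -- * L) ≤ √n` and `x ≤ 8 * L`; the constant is `8 + 2`, the `2` from `√n * x ≤ 2 * n`.
  rcases lt_or_ge x 4 with hx | hx
  · nlinarith
  have hL1 : (1 : ℝ) ≤ (⌊x / 4⌋₊ : ℝ) := by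
    exact_mod_cast Nat.le_floor (by push_cast; linarith)
  have hL2 : (⌊x / 4⌋₊ : ℝ) ≤ x / 4 := Nat.floor_le (by linarith)
  have hL3 : x / 4 < ⌊x / 4⌋₊ + 1 := Nat.lt_floor_add_one _
  generalize ⌊x / 4⌋₊ = L at *
  have h1 : (lexSize T : ℝ) * L ≤ T.length + (σ + 1) ^ L * L := by exact_mod_cast hmul L
  have h2 : ((σ : ℝ) + 1) ^ L ≤ √(T.length : ℝ) := by
    calc ((σ : ℝ) + 1) ^ L ≤ ((σ : ℝ) ^ 2) ^ L := by gcongr; nlinarith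
      _ = (σ : ℝ) ^ ((2 * L : ℕ) : ℝ) := by rw [Real.rpow_natCast, pow_mul]
      _ ≤ (σ : ℝ) ^ (x / 2) := by
        apply Real.rpow_le_rpow_of_exponent_le (by linarith)
        push_cast
        linarith
      _ = √(T.length : ℝ) := by
        rw [Real.sqrt_eq_rpow, ← hpow, ← Real.rpow_mul (by linarith)]
        ring_nf
  have h3 : (lexSize T : ℝ) * L ≤ T.length + √(T.length : ℝ) * L := by
    nlinarith
  have h4 : ((lexSize T : ℝ) - √(T.length : ℝ)) * x ≤ 8 * T.length := by
    rcases le_or_gt ((lexSize T : ℝ) - √(T.length : ℝ)) 0 with h | h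
    · nlinarith
    · calc _ ≤ ((lexSize T : ℝ) - √(T.length : ℝ)) * (8 * L) := by gcongr; linarith
        _ ≤ _ := by linarith
  nlinarith

/-! ### Empirical probabilities -/

theorem win_succ_eq_cons (T : List ℕ) (m u : ℕ) :
    win T (m + 1) u = sym T u :: win T m (u + 1) := by
  simp [win, List.range_succ_eq_map, Function.comp_def, Nat.add_assoc, Nat.add_comm 1]

theorem win_succ_eq_append (T : List ℕ) (m u : ℕ) :
    win T (m + 1) u = win T m u ++ [sym T (u + m)] := by
  simp [win, List.range_succ]

/-- The sliding of contexts in `wordProb`; it is also right for the empty context, `m = 0`. -/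
theorem drop_win_append (T : List ℕ) (m u : ℕ) :
    (win T m u ++ [sym T (u + m)]).drop 1 = win T m (u + 1) := by
  rw [← win_succ_eq_append, win_succ_eq_cons, List.drop_one, List.tail_cons]

theorem take_drop_eq_win {T : List ℕ} {m u : ℕ} (h : u + m ≤ T.length) :
    (T.drop u).take m = win T m u := by
  apply List.ext_getElem
  · simp [win]
    omega
  · intro j h1 h2
    have : j < m := by simpa [win] using h2
    rw [List.getElem_take, List.getElem_drop]
    simp only [win, sym, List.getElem_map, List.getElem_range]
    exact (List.getD_eq_getElem _ _ _).symm

/-- The positions (shifted by `k`) of the symbols of `T` with the context `w` of length `k`. -/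
def contextFiber (T : List ℕ) (k : ℕ) (w : List ℕ) : Finset ℕ :=
  (Finset.range (T.length - k)).filter fun i => win T k i = w

/-- The empirical probability of the symbol `c` in the context `w` of length `k`. -/
noncomputable def empProb (T : List ℕ) (k : ℕ) (w : List ℕ) (c : ℕ) : ℝ :=
  (((contextFiber T k w).filter fun i => sym T (i + k) = c).card : ℝ) / (contextFiber T k w).card

theorem empProb_nonneg (T : List ℕ) (k : ℕ) (w : List ℕ) (c : ℕ) : 0 ≤ empProb T k w c := by
  unfold empProb
  positivity

theorem empProb_le_one (T : List ℕ) (k : ℕ) (w : List ℕ) (c : ℕ) : empProb T k w c ≤ 1 := by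
  apply div_le_one_of_le₀ _ (Nat.cast_nonneg _)
  exact_mod_cast Finset.card_filter_le _ _

theorem empProb_pos {T : List ℕ} {k i : ℕ} (hi : i < T.length - k) :
    0 < empProb T k (win T k i) (sym T (i + k)) := by
  have h1 : i ∈ contextFiber T k (win T k i) :=
    Finset.mem_filter.2 ⟨Finset.mem_range.2 hi, rfl⟩
  have h2 : i ∈ (contextFiber T k (win T k i)).filter fun j => sym T (j + k) = sym T (i + k) :=
    Finset.mem_filter.2 ⟨h1, rfl⟩
  exact div_pos (by exact_mod_cast Finset.card_pos.2 ⟨i, h2⟩)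
    (by exact_mod_cast Finset.card_pos.2 ⟨i, h1⟩)

/-- The sum is `1`, or `0` for a context that does not occur, where the quotients are `0 / 0`. -/
theorem IsText.sum_empProb_le_one {σ : ℕ} {T : List ℕ} (hT : IsText σ T) (k : ℕ) (w : List ℕ) :
    ∑ c ∈ Finset.range (σ + 1), empProb T k w c ≤ 1 := by
  unfold empProb
  rw [← Finset.sum_div, ← Nat.cast_sum, ← Finset.card_eq_sum_card_fiberwise]
  · exact div_self_le_one _
  · intro i _
    simpa using Nat.lt_succ_of_le (hT.sym_le (i + k))

theorem following_eq {T w : List ℕ} {k : ℕ} (hw : w.length = k) :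
    following T w = ((List.range (T.length - k)).filter
      (fun i => decide (win T k i = w))).map (fun i => sym T (i + k)) := by
  subst hw
  unfold following
  congr 1
  refine List.filter_congr fun i hi => ?_
  rw [take_drop_eq_win (by have := List.mem_range.1 hi; omega)]

theorem length_following {T w : List ℕ} {k : ℕ} (hw : w.length = k) :
    (following T w).length = (contextFiber T k w).card := by
  rw [following_eq hw, List.length_map]
  rfl

theorem count_following {T w : List ℕ} {k : ℕ} (hw : w.length = k) (c : ℕ) :
    (following T w).count c =
      ((contextFiber T k w).filter fun i => sym T (i + k) = c).card := by
  rw [following_eq hw, List.count, List.countP_map, List.countP_eq_length_filter,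
    List.filter_filter, contextFiber, Finset.filter_filter]
  change _ = ((List.range (T.length - k)).filter
    (fun i => decide (win T k i = w ∧ sym T (i + k) = c))).length
  congr 1
  refine List.filter_congr fun i _ => ?_
  rw [Bool.decide_and, Bool.and_comm]
  rfl

theorem toFinset_following {T w : List ℕ} {k : ℕ} (hw : w.length = k) :
    (following T w).toFinset = (contextFiber T k w).image fun i => sym T (i + k) := by
  ext c
  simp [following_eq hw, contextFiber]

/-- The number of bits of the symbol at position `i + k` under the empirical distribution. -/
noncomputable def cost (T : List ℕ) (k i : ℕ) : ℝ :=
  -Real.logb 2 (empProb T k (win T k i) (sym T (i + k)))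

theorem cost_nonneg (T : List ℕ) (k i : ℕ) : 0 ≤ cost T k i :=
  neg_nonneg.2 (Real.logb_nonpos (by norm_num) (empProb_nonneg _ _ _ _) (empProb_le_one _ _ _ _))

/-- Group the positions by context and then by symbol: the cost is constant on each group. -/
theorem length_mul_entropy (T : List ℕ) (hn : 0 < T.length) (k : ℕ) :
    (T.length : ℝ) * entropy T k = ∑ i ∈ Finset.range (T.length - k), cost T k i := by
  have hn' : (T.length : ℝ) ≠ 0 := by positivity
  rw [entropy, ← mul_assoc, mul_one_div_cancel hn', one_mul]
  have himg : (Finset.range (T.length - k)).image (fun i => (T.drop i).take k) =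
      (Finset.range (T.length - k)).image (win T k) := by
    refine Finset.image_congr fun i hi => ?_
    exact take_drop_eq_win (by have := Finset.mem_range.1 hi; omega)
  rw [himg, ← Finset.sum_fiberwise_of_maps_to (g := win T k)
    (fun i hi => Finset.mem_image_of_mem _ hi) (cost T k)]
  refine Finset.sum_congr rfl fun w hw => ?_
  obtain ⟨i, hi, rfl⟩ := Finset.mem_image.1 hw
  set w := win T k i with hwdef
  have hlen : w.length = k := by simp [hwdef, win]
  have hpos : 0 < (contextFiber T k w).card :=
    Finset.card_pos.2 ⟨i, Finset.mem_filter.2 ⟨hi, rfl⟩⟩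
  have hpos' : ((contextFiber T k w).card : ℝ) ≠ 0 := by positivity
  change _ = ∑ i ∈ contextFiber T k w, cost T k i
  rw [entropyZero, toFinset_following hlen, length_following hlen, Finset.mul_sum,
    ← Finset.sum_fiberwise_of_maps_to (g := fun i => sym T (i + k))
      (fun i hi => Finset.mem_image_of_mem (fun i => sym T (i + k)) hi) (cost T k)]
  refine Finset.sum_congr rfl fun c _ => ?_
  rw [count_following hlen, ← mul_assoc, mul_div_cancel₀ _ hpos', ← nsmul_eq_mul]
  refine (Finset.sum_eq_card_nsmul fun j hj => ?_).symm
  obtain ⟨hj1, rfl⟩ := Finset.mem_filter.1 hj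
  have hj2 : win T k j = w := (Finset.mem_filter.1 hj1).2
  rw [cost, hj2, empProb, ← Real.logb_inv, inv_div]

/-! ### Probabilities of words -/

/-- The probability of a word that follows `w`, if `q w c` is the probability of `c` after `w`. -/
def wordProb (q : List ℕ → ℕ → ℝ) : List ℕ → List ℕ → ℝ
  | _, [] => 1
  | w, c :: Y => q w c * wordProb q ((w ++ [c]).drop 1) Y

theorem wordProb_nonneg {q : List ℕ → ℕ → ℝ} (hq : ∀ w c, 0 ≤ q w c) (w Y : List ℕ) :
    0 ≤ wordProb q w Y := by
  induction Y generalizing w with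
  | nil => exact zero_le_one
  | cons c Y ih => exact mul_nonneg (hq w c) (ih _)

theorem sum_wordProb_le_one {q : List ℕ → ℕ → ℝ} (hq : ∀ w c, 0 ≤ q w c) {a : ℕ}
    (hs : ∀ w, ∑ c ∈ Finset.range a, q w c ≤ 1) (m : ℕ) (w : List ℕ) :
    ∑ Y ∈ words a m, wordProb q w Y ≤ 1 := by
  induction m generalizing w with
  | zero => simp [words, wordProb]
  | succ m ih =>
    rw [words, Finset.sum_map, Finset.sum_product]
    refine le_trans (Finset.sum_le_sum fun c _ => ?_) (hs w)
    change ∑ Y ∈ words a m, q w c * wordProb q ((w ++ [c]).drop 1) Y ≤ q w c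
    rw [← Finset.mul_sum]
    exact mul_le_of_le_one_right (hq w c) (ih _)

theorem wordProb_win (q : List ℕ → ℕ → ℝ) (T : List ℕ) (k m i : ℕ) :
    wordProb q (win T k i) (win T m (i + k)) =
      ∏ j ∈ Finset.range m, q (win T k (i + j)) (sym T (i + j + k)) := by
  induction m generalizing i with
  | zero => simp [win, wordProb]
  | succ m ih =>
    rw [win_succ_eq_cons, wordProb, drop_win_append, show i + k + 1 = i + 1 + k by omega, ih,
      Finset.prod_range_succ', mul_comm]
    simp only [Nat.add_zero]
    congr 1
    refine Finset.prod_congr rfl fun j _ => ?_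
    rw [show i + 1 + j = i + (j + 1) by omega]

/-- Gibbs' inequality for subprobabilities scaled by `Z`. -/
theorem card_mul_logb_card_le {ι : Type*} (S : Finset ι) (Q : ι → ℝ) (hQ : ∀ i ∈ S, 0 < Q i)
    {Z : ℝ} (hZ : 0 < Z) (hsum : ∑ i ∈ S, Q i ≤ Z) :
    (S.card : ℝ) * Real.logb 2 S.card ≤
      ∑ i ∈ S, -Real.logb 2 (Q i) + S.card * Real.logb 2 Z := by
  rcases S.eq_empty_or_nonempty with rfl | hS
  · simp
  have hc : (0 : ℝ) < S.card := by exact_mod_cast hS.card_pos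
  have h1 : ∑ i ∈ S, (Real.log (Q i) + Real.log S.card - Real.log Z) ≤
      ∑ i ∈ S, (Q i * (S.card / Z) - 1) := by
    refine Finset.sum_le_sum fun i hi => ?_
    have := Real.log_le_sub_one_of_pos
      (mul_pos (hQ i hi) (div_pos hc hZ))
    rw [Real.log_mul (hQ i hi).ne' (by positivity), Real.log_div hc.ne' hZ.ne'] at this
    linarith
  have h2 : ∑ i ∈ S, (Q i * (S.card / Z) - 1) ≤ 0 := by
    rw [Finset.sum_sub_distrib, ← Finset.sum_mul, Finset.sum_const, nsmul_eq_mul, mul_one,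
      sub_nonpos]
    calc _ ≤ Z * (S.card / Z) := by gcongr
      _ = _ := by field_simp
  rw [Finset.sum_sub_distrib, Finset.sum_add_distrib, Finset.sum_const, Finset.sum_const,
    nsmul_eq_mul, nsmul_eq_mul] at h1
  have hl := Real.log_pos (show (1 : ℝ) < 2 by norm_num)
  simp only [Real.logb]
  rw [Finset.sum_neg_distrib, ← Finset.sum_div, ← mul_div_assoc, ← mul_div_assoc, ← neg_div,
    ← add_div]
  exact div_le_div_of_nonneg_right (by linarith) hl.le

/-! ### The lex-parse and the empirical entropy -/

/-- `Q t` is the empirical probability of the phrase at `t` after its context. The costs add up to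
at most `n * H_k` by disjointness. Among phrases of one length, phrase and next symbol determine
`t`, so the `Q t` sum to at most `1` for each context and next symbol: `(σ + 1) ^ (k + 1)` in all,
times `L` lengths. -/
theorem IsText.card_mul_logb_le {σ : ℕ} {T : List ℕ} (hT : IsText σ T) {k L : ℕ} (hL : 1 ≤ L)
    {S : Finset ℕ} (hS : ∀ i ∈ S, i < T.length)
    (hsep : ∀ i ∈ S, ∀ j ∈ S, i < j → i + phraseLen T i ≤ j)
    (hk : ∀ i ∈ S, k ≤ i) (hSL : ∀ i ∈ S, phraseLen T i ≤ L) :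
    (S.card : ℝ) * Real.logb 2 S.card ≤ T.length * entropy T k +
      S.card * Real.logb 2 (((σ : ℝ) + 1) ^ (k + 1) * L) := by
  set Q : ℕ → ℝ := fun t => wordProb (empProb T k) (win T k (t - k)) (win T (phraseLen T t) t)
    with hQdef
  have hQ : ∀ t ∈ S, Q t = ∏ j ∈ Finset.range (phraseLen T t),
      empProb T k (win T k (t - k + j)) (sym T (t - k + j + k)) := by
    intro t ht
    have := wordProb_win (empProb T k) T k (phraseLen T t) (t - k)
    rwa [Nat.sub_add_cancel (hk t ht)] at this
  have hin : ∀ t ∈ S, ∀ j ∈ Finset.range (phraseLen T t), t - k + j < T.length - k := by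
    intro t ht j hj
    have h1 := add_phraseLen_le (hS t ht)
    have h2 := hk t ht
    have h3 := Finset.mem_range.1 hj
    omega
  have hpos : ∀ t ∈ S, 0 < Q t := fun t ht => by
    rw [hQ t ht]
    exact Finset.prod_pos fun j hj => empProb_pos (hin t ht j hj)
  have hcost : ∑ t ∈ S, -Real.logb 2 (Q t) ≤ T.length * entropy T k := by
    have h1 : ∀ t ∈ S, -Real.logb 2 (Q t) =
        ∑ j ∈ Finset.range (phraseLen T t), cost T k (t - k + j) := by
      intro t ht
      rw [hQ t ht, Real.logb_prod _ _ fun j hj => (empProb_pos (hin t ht j hj)).ne',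
        ← Finset.sum_neg_distrib]
      rfl
    rw [Finset.sum_congr rfl h1, Finset.sum_sigma', length_mul_entropy T hT.length_pos]
    rw [← Finset.sum_image (s := S.sigma fun t => Finset.range (phraseLen T t))
      (g := fun x => x.1 - k + x.2) (f := cost T k)]
    · refine Finset.sum_le_sum_of_subset_of_nonneg ?_ fun i _ _ => cost_nonneg T k i
      intro i hi
      obtain ⟨⟨t, j⟩, hx, rfl⟩ := Finset.mem_image.1 hi
      rw [Finset.mem_sigma] at hx
      exact Finset.mem_range.2 (hin t hx.1 j hx.2)
    · rintro ⟨t, j⟩ hx ⟨t', j'⟩ hx' heq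
      simp only [Finset.mem_coe, Finset.mem_sigma, Finset.mem_range] at hx hx' heq
      have h1 := hsep t hx.1 t' hx'.1
      have h2 := hsep t' hx'.1 t hx.1
      have h3 := hk t hx.1
      have h4 := hk t' hx'.1
      obtain rfl : t = t' := by omega
      obtain rfl : j = j' := by omega
      rfl
  have hsum : ∑ t ∈ S, Q t ≤ ((σ : ℝ) + 1) ^ (k + 1) * L := by
    have hfib : ∀ l ∈ Finset.Icc 1 L,
        ∑ t ∈ S.filter (fun t => phraseLen T t = l), Q t ≤ ((σ : ℝ) + 1) ^ (k + 1) := by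
      intro l _
      set f : ℕ → List ℕ × List ℕ × ℕ := fun t => (win T k (t - k), win T l t, sym T (t + l))
      have h1 : ∑ t ∈ S.filter (fun t => phraseLen T t = l), Q t =
          ∑ x ∈ (S.filter (fun t => phraseLen T t = l)).image f,
            wordProb (empProb T k) x.1 x.2.1 := by
        rw [Finset.sum_image]
        · refine Finset.sum_congr rfl fun t ht => ?_
          obtain rfl := (Finset.mem_filter.1 ht).2
          rfl
        · intro t ht t' ht' heq
          obtain ⟨ht, hl⟩ := Finset.mem_filter.1 ht
          obtain ⟨ht', hl'⟩ := Finset.mem_filter.1 ht'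
          have h2 : win T (l + 1) t = win T (l + 1) t' := by
            simp only [f, Prod.mk.injEq] at heq
            rw [win_succ_eq_append, win_succ_eq_append, heq.2.1, heq.2.2]
          have h5 := plcp_le_phraseLen T t
          have h6 := plcp_le_phraseLen T t'
          exact hT.win_inj le_rfl (hS t ht) (by omega) le_rfl (hS t' ht') (by omega) h2
      rw [h1]
      have h2 : (S.filter (fun t => phraseLen T t = l)).image f ⊆
          words (σ + 1) k ×ˢ words (σ + 1) l ×ˢ Finset.range (σ + 1) := by
        intro x hx
        obtain ⟨t, -, rfl⟩ := Finset.mem_image.1 hx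
        simp only [f, Finset.mem_product]
        exact ⟨hT.win_mem_words _ _, hT.win_mem_words _ _,
          Finset.mem_range.2 (Nat.lt_succ_of_le (hT.sym_le _))⟩
      refine (Finset.sum_le_sum_of_subset_of_nonneg h2 fun x _ _ =>
        wordProb_nonneg (empProb_nonneg T k) _ _).trans ?_
      rw [Finset.sum_product]
      calc _ ≤ ∑ w ∈ words (σ + 1) k, ((σ : ℝ) + 1) := by
            refine Finset.sum_le_sum fun w _ => ?_
            rw [Finset.sum_product]
            simp only [Finset.sum_const, Finset.card_range, nsmul_eq_mul]
            rw [← Finset.mul_sum]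
            push_cast
            exact mul_le_of_le_one_right (by positivity)
              (sum_wordProb_le_one (empProb_nonneg T k) (hT.sum_empProb_le_one k) l w)
        _ = _ := by
            rw [Finset.sum_const, card_words, nsmul_eq_mul]
            push_cast
            ring
    rw [← Finset.sum_fiberwise_of_maps_to (t := Finset.Icc 1 L) (g := phraseLen T)
      fun t ht => Finset.mem_Icc.2 ⟨phraseLen_pos T t, hSL t ht⟩]
    refine (Finset.sum_le_sum hfib).trans ?_
    rw [Finset.sum_const, Nat.card_Icc, nsmul_eq_mul, mul_comm]
    simp
  have hL' : (0 : ℝ) < L := by exact_mod_cast hL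
  have := card_mul_logb_card_le S Q hpos (by positivity) hsum
  linarith

/-- `x` counts the phrases shorter than `L` with a full context; at most `k` starts lack one, and at
most `n / L` phrases are long. -/
theorem IsText.exists_card_mul_logb_le {σ : ℕ} {T : List ℕ} (hT : IsText σ T) (k : ℕ) {L : ℕ}
    (hL : 1 ≤ L) : ∃ x : ℕ, x ≤ lexSize T ∧ lexSize T * L ≤ (x + k) * L + T.length ∧
      (x : ℝ) * Real.logb 2 x ≤ T.length * entropy T k +
        x * Real.logb 2 (((σ : ℝ) + 1) ^ (k + 1) * L) := by
  obtain ⟨P, hc, hP, hsep⟩ := exists_starts T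
  set R := P.filter fun t => ¬ L ≤ phraseLen T t with hR
  set S := R.filter fun t => ¬ t < k with hS
  have hSP : S ⊆ P := (Finset.filter_subset _ _).trans (Finset.filter_subset _ _)
  refine ⟨S.card, hc ▸ Finset.card_le_card hSP, ?_, ?_⟩
  · have h1 := card_long_mul_le hP hsep L
    have h2 := Finset.card_filter_add_card_filter_not (s := P) (fun t => L ≤ phraseLen T t)
    have h3 := Finset.card_filter_add_card_filter_not (s := R) (fun t => t < k)
    have h4 : (R.filter fun t => t < k).card ≤ k := by
      refine (Finset.card_le_card (t := Finset.range k) fun t ht => ?_).trans_eq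
        (Finset.card_range k)
      exact Finset.mem_range.2 (Finset.mem_filter.1 ht).2
    rw [← hR] at h2
    rw [← hS] at h3
    rw [← hc, ← h2, add_mul, add_comm]
    exact Nat.add_le_add (Nat.mul_le_mul_right _ (by omega)) h1
  · refine hT.card_mul_logb_le hL (fun i hi => hP i (hSP hi))
      (fun i hi j hj => hsep i (hSP hi) j (hSP hj)) (fun i hi => ?_) (fun i hi => ?_)
    · exact not_lt.1 (Finset.mem_filter.1 hi).2
    · exact (not_le.1 (Finset.mem_filter.1 (Finset.mem_filter.1 hi).1).2).le

theorem mul_le_of_mul_sq_le {η l n y : ℝ} (hl : 0 < l) (hn : 0 ≤ n) (h1 : 1 ≤ η ^ 2 * l)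
    (hy : y * l ^ 2 ≤ n) : y * l ≤ η ^ 2 * n := by
  have h2 : n * 1 ≤ n * (η ^ 2 * l) := mul_le_mul_of_nonneg_left h1 hn
  have h3 : (y * l) * l ≤ (η ^ 2 * n) * l := by linarith
  exact le_of_mul_le_mul_right h3 hl

/-- The bound for `x` phrases, where `l`, `a`, `X`, `Y` stand for the logarithms of `n` (to the
base `σ`), `σ`, `x`, `l`, and `W` for the logarithm of the number of contexts and lengths. -/
theorem mul_log_le_of_gibbs {η l a n x k H W X Y : ℝ} (hη0 : 0 < η) (hη1 : η ≤ 1)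
    (hl : 1 ≤ l) (ha : 1 ≤ a) (hn : 0 ≤ n) (hx : 0 ≤ x) (hH : 0 ≤ H)
    (h1 : 1 ≤ η ^ 2 * l) (hk : k ≤ η ^ 2 * l) (hxl : x * l ≤ 10 * n)
    (hX : x * X ≤ H + x * W) (hW : W ≤ (k + 1) * (2 * a) + (1 + 2 * Y)) (hY : Y ≤ 2 * √l)
    (hla : n < x * l ^ 2 → l * a ≤ X + 2 * Y) :
    x * (l * a) ≤ H + 130 * η * (n * a) := by
  have hη2 : η ^ 2 ≤ η := by nlinarith
  have hna : 0 ≤ n * a := by positivity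
  -- At most `n / l²` phrases are negligible. Otherwise `log x ≥ log n - 2 log l`, and what is lost
  -- is `O(η * l * a)` per phrase; `130 = 13 * 10`.
  rcases le_or_gt (x * l ^ 2) n with hc | hc
  · have h2 := mul_le_of_mul_sq_le (by linarith) hn h1 hc
    have h3 : x * l * a ≤ η ^ 2 * n * a := mul_le_mul_of_nonneg_right h2 (by linarith)
    have h4 : η ^ 2 * (n * a) ≤ 130 * η * (n * a) :=
      mul_le_mul_of_nonneg_right (by linarith) hna
    linarith
  · have hs0 := Real.sqrt_pos.2 (show (0 : ℝ) < l by linarith)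
    have hss := Real.sq_sqrt (show (0 : ℝ) ≤ l by linarith)
    have h2 := hla hc
    have h5 : 1 ≤ η * √l := by
      by_contra hlt
      have h0 : 0 < η * √l := by positivity
      have : η ^ 2 * l = (η * √l) ^ 2 := by rw [mul_pow, hss]
      nlinarith
    have h6 : 2 * k + 3 + 8 * √l ≤ 13 * (η * l) := by
      have e1 : η ^ 2 * l ≤ η * l := mul_le_mul_of_nonneg_right hη2 (by linarith)
      have e2 : √l * 1 ≤ √l * (η * √l) := mul_le_mul_of_nonneg_left h5 hs0.le
      have e3 : √l * (η * √l) = η * √l ^ 2 := by ring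
      rw [hss] at e3
      linarith
    have h7 : W + 2 * Y ≤ a * (13 * (η * l)) := by
      have e1 : 1 * (1 + 8 * √l) ≤ a * (1 + 8 * √l) :=
        mul_le_mul_of_nonneg_right ha (by positivity)
      have e2 := mul_le_mul_of_nonneg_left h6 (show 0 ≤ a by linarith)
      linarith
    have h8 := mul_le_mul_of_nonneg_left h2 hx
    have h9 := mul_le_mul_of_nonneg_left h7 hx
    have h10 := mul_le_mul_of_nonneg_left hxl (show 0 ≤ 13 * η * a by positivity)
    linarith

theorem IsText.lexSize_mul_logb_le {ε : ℝ} (hε : 0 < ε) : ∃ δ : ℝ, 0 < δ ∧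
    ∀ (σ : ℕ) (T : List ℕ) (k : ℕ), 2 ≤ σ → IsText σ T →
      1 ≤ δ * Real.logb (σ : ℝ) (T.length : ℝ) →
      (k : ℝ) ≤ δ * Real.logb (σ : ℝ) (T.length : ℝ) →
      (lexSize T : ℝ) * Real.logb 2 (T.length : ℝ) ≤
        (T.length : ℝ) * entropy T k + ε * ((T.length : ℝ) * Real.logb 2 (σ : ℝ)) := by
  -- `135 = 130 + 1 + 4`: the main bound, the long phrases and the phrases without a full context.
  obtain ⟨η, hη0, hη1, hηε⟩ : ∃ η : ℝ, 0 < η ∧ η ≤ 1 ∧ 135 * η ≤ ε :=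
    ⟨min 1 (ε / 135), by positivity, min_le_left _ _, by
      have := min_le_right 1 (ε / 135); linarith⟩
  refine ⟨η ^ 2, by positivity, fun σ T k hσ hT h1 hk => ?_⟩
  have hσ' : (2 : ℝ) ≤ σ := by exact_mod_cast hσ
  have hnpos : (1 : ℝ) ≤ T.length := by exact_mod_cast hT.length_pos
  have hH : 0 ≤ (T.length : ℝ) * entropy T k := by
    rw [length_mul_entropy T hT.length_pos]
    exact Finset.sum_nonneg fun i _ => cost_nonneg T k i
  have hη2 : η ^ 2 ≤ η := by nlinarith
  have hlog : Real.logb 2 (T.length : ℝ) =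
      Real.logb (σ : ℝ) (T.length : ℝ) * Real.logb 2 (σ : ℝ) := by
    rw [mul_comm, Real.mul_logb (by linarith) (by linarith) (by linarith)]
  have hl2 : Real.logb σ T.length ≤ 2 * √(T.length : ℝ) :=
    (logb_le_logb_two hσ hnpos).trans (logb_two_le_two_mul_sqrt (by linarith))
  have hpow : (σ : ℝ) ^ Real.logb σ T.length = T.length :=
    Real.rpow_logb (by linarith) (by linarith) (by linarith)
  have hl0 : 0 ≤ Real.logb (σ : ℝ) (T.length : ℝ) := Real.logb_nonneg (by linarith) hnpos
  have hl1 : 1 ≤ Real.logb (σ : ℝ) (T.length : ℝ) := by nlinarith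
  have hn2 : (2 : ℝ) ≤ T.length := by
    rw [← hpow]
    calc (2 : ℝ) ≤ σ := hσ'
      _ = (σ : ℝ) ^ (1 : ℝ) := (Real.rpow_one _).symm
      _ ≤ _ := Real.rpow_le_rpow_of_exponent_le (by linarith) hl1
  have hv := hT.lexSize_le_div_logb hσ (by exact_mod_cast hn2)
  have hsq := Real.sq_sqrt (show (0 : ℝ) ≤ T.length by linarith)
  have hs0 := Real.sqrt_nonneg (T.length : ℝ)
  have ha : 1 ≤ Real.logb 2 (σ : ℝ) := by
    rw [Real.le_logb_iff_rpow_le (by norm_num) (by linarith), Real.rpow_one]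
    exact hσ'
  have hσ1 : Real.logb 2 ((σ : ℝ) + 1) ≤ 2 * Real.logb 2 (σ : ℝ) := by
    have : (2 : ℝ) * Real.logb 2 (σ : ℝ) = Real.logb 2 ((σ : ℝ) ^ 2) := by
      rw [Real.logb_pow]; norm_num
    rw [this]
    exact Real.logb_le_logb_of_le (by norm_num) (by linarith) (by nlinarith)
  clear hpow hσ' hσ
  generalize Real.logb (σ : ℝ) (T.length : ℝ) = l at *
  rw [← mul_div_assoc, le_div_iff₀ (by linarith)] at hv
  -- The threshold `⌈l²⌉` makes the long phrases negligible while its logarithm stays `O(log l)`.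
  have hL1 : l ^ 2 ≤ (⌈l ^ 2⌉₊ : ℝ) := Nat.le_ceil _
  have hL2 : (⌈l ^ 2⌉₊ : ℝ) < l ^ 2 + 1 := Nat.ceil_lt_add_one (by positivity)
  have hL0 : 1 ≤ ⌈l ^ 2⌉₊ := by
    rw [Nat.one_le_ceil_iff]
    positivity
  generalize ⌈l ^ 2⌉₊ = L at *
  obtain ⟨x, hxv, hx1, hx2⟩ := hT.exists_card_mul_logb_le k hL0
  have hxv' : (x : ℝ) ≤ lexSize T := by exact_mod_cast hxv
  have hx1' : (lexSize T : ℝ) * L ≤ (x + k) * L + T.length := by exact_mod_cast hx1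
  have hLpos : (1 : ℝ) ≤ L := by exact_mod_cast hL0
  have hW : Real.logb 2 (((σ : ℝ) + 1) ^ (k + 1) * L) ≤
      (k + 1) * (2 * Real.logb 2 (σ : ℝ)) + (1 + 2 * Real.logb 2 l) := by
    have h3 : Real.logb 2 (L : ℝ) ≤ 1 + 2 * Real.logb 2 l := by
      calc Real.logb 2 (L : ℝ) ≤ Real.logb 2 (2 * l ^ 2) :=
            Real.logb_le_logb_of_le (by norm_num) (by linarith) (by nlinarith)
        _ = _ := by
            rw [Real.logb_mul (by norm_num) (by positivity), Real.logb_pow,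
              Real.logb_self_eq_one (by norm_num)]
            norm_num
    rw [Real.logb_mul (by positivity) (by positivity), Real.logb_pow]
    push_cast
    exact add_le_add (mul_le_mul_of_nonneg_left hσ1 (by positivity)) h3
  have hla : (T.length : ℝ) < (x : ℝ) * l ^ 2 →
      l * Real.logb 2 (σ : ℝ) ≤ Real.logb 2 x + 2 * Real.logb 2 l := by
    intro hc
    have hxpos : (x : ℝ) ≠ 0 := fun h => by
      rw [h] at hc
      linarith
    rw [← hlog]
    calc Real.logb 2 (T.length : ℝ) ≤ Real.logb 2 ((x : ℝ) * l ^ 2) :=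
          Real.logb_le_logb_of_le (by norm_num) (by linarith) hc.le
      _ = _ := by
          rw [Real.logb_mul hxpos (by positivity), Real.logb_pow]
          norm_num
  rw [hlog]
  have hlen : (0 : ℝ) ≤ T.length := by linarith
  have hxl : (x : ℝ) * l ≤ 10 * T.length :=
    (mul_le_mul_of_nonneg_right hxv' hl0).trans hv
  have hmain := mul_log_le_of_gibbs hη0 hη1 hl1 ha hlen (Nat.cast_nonneg x) hH
    h1 hk hxl hx2 hW (logb_two_le_two_mul_sqrt (by linarith)) hla
  have hln : l ^ 2 ≤ 4 * T.length := by nlinarith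
  have hkl : (k : ℝ) * l ≤ 4 * η ^ 2 * T.length := by
    have e1 : (k : ℝ) * l ≤ (η ^ 2 * l) * l := mul_le_mul_of_nonneg_right hk hl0
    have e2 : η ^ 2 * l ^ 2 ≤ η ^ 2 * (4 * T.length) :=
      mul_le_mul_of_nonneg_left hln (by positivity)
    linarith
  have hvx : ((lexSize T : ℝ) - x - k) * l ^ 2 ≤ T.length := by
    rcases le_or_gt ((lexSize T : ℝ) - x - k) 0 with h | h
    · nlinarith [sq_nonneg l]
    · have := mul_le_mul_of_nonneg_left hL1 h.le
      linarith
  have h2 := mul_le_of_mul_sq_le (by linarith) hlen h1 hvx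
  generalize Real.logb 2 (σ : ℝ) = a at *
  have ha0 : 0 ≤ a := by linarith
  have hna : 0 ≤ (T.length : ℝ) * a := by positivity
  have h3 := mul_le_mul_of_nonneg_right h2 ha0
  have h4 := mul_le_mul_of_nonneg_right hkl ha0
  have h5 := mul_le_mul_of_nonneg_right hη2 hna
  have h6 := mul_le_mul_of_nonneg_right hηε hna
  linarith

/-! ### Binary texts whose Burrows-Wheeler transform has many runs -/

theorem exists_run_start {T : List ℕ} {x y : ℕ} (hxy : x < y) (h : BWT T x ≠ BWT T y) :
    ∃ z, x < z ∧ z ≤ y ∧ BWT T (z - 1) ≠ BWT T z := by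
  induction y, Nat.succ_le_of_lt hxy using Nat.le_induction with
  | base => exact ⟨x + 1, by omega, le_rfl, h⟩
  | succ y hy ih =>
    by_cases hB : BWT T y = BWT T (y + 1)
    · obtain ⟨z, h1, h2, h3⟩ := ih hy (hB ▸ h)
      exact ⟨z, h1, by omega, h3⟩
    · exact ⟨y + 1, by omega, le_rfl, hB⟩

/-- The transform differs at the ranks of `i + 1` and `j + 1`, so a run starts between them, and all
ranks between them share the window (`Agree.between`). -/
theorem exists_run_start_win {T : List ℕ} {m i j : ℕ} (hi : i + 1 + m ≤ T.length)
    (hj : j + 1 + m ≤ T.length) (hm : 1 ≤ m) (hw : win T m (i + 1) = win T m (j + 1))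
    (hne : sym T i ≠ sym T j) :
    ∃ z < T.length, BWT T (z - 1) ≠ BWT T z ∧ win T m (SA T z) = win T m (i + 1) := by
  have key : ∀ i j, i + 1 + m ≤ T.length → j + 1 + m ≤ T.length →
      win T m (i + 1) = win T m (j + 1) → sym T i ≠ sym T j →
      ISA T (i + 1) < ISA T (j + 1) →
      ∃ z < T.length, BWT T (z - 1) ≠ BWT T z ∧ win T m (SA T z) = win T m (i + 1) := by
    intro i j hi hj hw hne hlt
    have hi' : i + 1 < T.length := by omega
    have hj' : j + 1 < T.length := by omega
    have hB : BWT T (ISA T (i + 1)) ≠ BWT T (ISA T (j + 1)) := by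
      rw [BWT, BWT, SA_ISA hi', SA_ISA hj']
      simpa using hne
    obtain ⟨z, h1, h2, h3⟩ := exists_run_start hlt hB
    have hy := ISA_lt hj'
    refine ⟨z, by omega, h3, ?_⟩
    rcases h2.lt_or_eq with h4 | rfl
    · have h5 := SA_strictMono (T := T) h1 (by omega)
      have h6 := SA_strictMono h4 hy
      rw [SA_ISA hi'] at h5
      rw [SA_ISA hj'] at h6
      have hag : Agree T m (i + 1) (j + 1) := ⟨hi, hj, win_eq_iff.1 hw⟩
      rw [hw]
      exact win_eq_iff.2 (hag.between h5 h6).2.2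
    · rw [SA_ISA hj', hw]
  have hij : ISA T (i + 1) ≠ ISA T (j + 1) := fun e => by
    have := congrArg (SA T) e
    rw [SA_ISA (by omega), SA_ISA (by omega)] at this
    exact hne (by rw [Nat.succ_injective this])
  rcases lt_or_gt_of_ne hij with h | h
  · exact key i j hi hj hw hne h
  · rw [hw]
    exact key j i hj hi hw.symm hne.symm h

/-- If both `c w` and `d w` occur, for some symbols `c ≠ d`, then there is a run of the
Burrows-Wheeler transform that starts in the range of `w`. -/
theorem card_le_bwtRuns {ι : Type*} {T : List ℕ} {m : ℕ} (hm : 1 ≤ m) (G : Finset ι)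
    (i j : ι → ℕ) (hi : ∀ g ∈ G, i g + 1 + m ≤ T.length) (hj : ∀ g ∈ G, j g + 1 + m ≤ T.length)
    (hw : ∀ g ∈ G, win T m (i g + 1) = win T m (j g + 1))
    (hne : ∀ g ∈ G, sym T (i g) ≠ sym T (j g))
    (hinj : ∀ g ∈ G, ∀ g' ∈ G, win T m (i g + 1) = win T m (i g' + 1) → g = g') :
    G.card ≤ bwtRuns T := by
  have := fun g hg => exists_run_start_win (hi g hg) (hj g hg) hm (hw g hg) (hne g hg)
  choose! z hz1 hz2 hz3 using this
  refine Finset.card_le_card_of_injOn z (fun g hg => ?_) fun g hg g' hg' h => ?_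
  · rw [Finset.mem_coe, Finset.mem_filter, Finset.mem_range]
    exact ⟨hz1 g hg, Or.inr (hz2 g hg)⟩
  · exact hinj g hg g' hg' (by rw [← hz3 g hg, ← hz3 g' hg', h])

open Polynomial in
/-- A linear shift register sequence of maximal period, from a generator of a finite field. -/
theorem exists_shift_register_of_field {K F : Type*} [Field K] [Field F] [Finite F] [Algebra K F]
    [FiniteDimensional K F] : ∃ s : ℕ → K,
    ∀ g : Fin (Module.finrank K F) → K, g ≠ 0 →
      ∃ j < Nat.card F, ∀ i : Fin (Module.finrank K F), s (j + i) = g i := by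
  classical
  obtain ⟨α, hα⟩ := IsCyclic.exists_generator (α := Fˣ)
  have hpow : ∀ x : F, x ≠ 0 → ∃ j < Nat.card F, (α : F) ^ j = x := by
    intro x hx
    have h1 := mem_zpowers_iff_mem_range_orderOf.1 (hα (Units.mk0 x hx))
    obtain ⟨j, hj, hjx⟩ := Finset.mem_image.1 h1
    refine ⟨j, ?_, ?_⟩
    · calc j < orderOf α := Finset.mem_range.1 hj
        _ ≤ Nat.card Fˣ := orderOf_le_card
        _ ≤ Nat.card F := by rw [Nat.card_units]; omega
    · have := congrArg Units.val hjx
      simpa using this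
  obtain ⟨φ, hφ⟩ : ∃ φ : Module.Dual K F, φ 1 ≠ 0 := by
    by_contra hc
    push Not at hc
    exact one_ne_zero ((Module.forall_dual_apply_eq_zero_iff K (1 : F)).1 hc)
  -- `Φ (α ^ j)` is the window at `j` of the sequence `φ (α ^ j)`. If `Φ x = 0`, then `φ (y * x) =
  -- 0` for every `y`, because reduction modulo the minimal polynomial writes each power of `α`
  -- through the lower ones; `y = x⁻¹` then contradicts `φ 1 ≠ 0`. By dimension `Φ` is onto, and
  -- each nonzero `x` is a power of `α`.
  let Φ : F →ₗ[K] (Fin (Module.finrank K F) → K) :=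
    LinearMap.pi fun i => φ ∘ₗ LinearMap.mulLeft K ((α : F) ^ (i : ℕ))
  have hΦ : ∀ x i, Φ x i = φ ((α : F) ^ (i : ℕ) * x) := fun x i => rfl
  have hinj : Function.Injective Φ := by
    rw [← LinearMap.ker_eq_bot, LinearMap.ker_eq_bot']
    intro x hx
    by_contra hx0
    have hz : ∀ y : F, φ (y * x) = 0 := by
      intro y
      by_cases hy : y = 0
      · simp [hy]
      obtain ⟨j, -, rfl⟩ := hpow y hy
      have hint : IsIntegral K (α : F) := Algebra.IsIntegral.isIntegral _
      have h1 := aeval_modByMonic_eq_self_of_root (p := (X : K[X]) ^ j)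
        (minpoly.aeval K (α : F))
      have hdeg : ((X : K[X]) ^ j %ₘ minpoly K (α : F)).natDegree < Module.finrank K F :=
        (natDegree_modByMonic_lt _ (minpoly.monic hint) (minpoly.ne_one _ _)).trans_le
          (minpoly.natDegree_le _)
      rw [aeval_eq_sum_range' hdeg, map_pow, aeval_X] at h1
      rw [← h1, Finset.sum_mul, map_sum]
      refine Finset.sum_eq_zero fun i hi => ?_
      have := congrFun hx ⟨i, Finset.mem_range.1 hi⟩
      rw [hΦ] at this
      rw [smul_mul_assoc, map_smul, this]
      simp
    apply hφ
    have := hz x⁻¹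
    rwa [inv_mul_cancel₀ hx0] at this
  have hsurj : Function.Surjective Φ :=
    (LinearMap.injective_iff_surjective_of_finrank_eq_finrank (by simp)).1 hinj
  refine ⟨fun j => φ ((α : F) ^ j), fun g hg => ?_⟩
  obtain ⟨x, rfl⟩ := hsurj g
  obtain ⟨j, hj, rfl⟩ := hpow x (fun h => hg (by rw [h, map_zero]))
  refine ⟨j, hj, fun i => ?_⟩
  rw [hΦ, ← pow_add, add_comm]

/-- A binary linear shift register sequence of maximal period. -/
theorem exists_shift_register (k : ℕ) (hk : k ≠ 0) : ∃ s : ℕ → ZMod 2,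
    ∀ g : Fin k → ZMod 2, g ≠ 0 → ∃ j < 2 ^ k, ∀ i : Fin k, s (j + i) = g i := by
  have : Fact (Nat.Prime 2) := ⟨Nat.prime_two⟩
  have hcard : Nat.card (GaloisField 2 k) = 2 ^ k := GaloisField.card 2 k hk
  have hrank : Module.finrank (ZMod 2) (GaloisField 2 k) = k := GaloisField.finrank 2 hk
  have : Finite (GaloisField 2 k) := Nat.finite_of_card_ne_zero (by rw [hcard]; positivity)
  have : FiniteDimensional (ZMod 2) (GaloisField 2 k) :=
    Module.finite_of_finrank_pos (by omega)
  have h := exists_shift_register_of_field (K := ZMod 2) (F := GaloisField 2 k)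
  rwa [hcard, hrank] at h

/-- Binary texts of length `Θ(2 ^ m)` whose Burrows-Wheeler transform has `Ω(2 ^ m)` runs. -/
theorem exists_text_bwtRuns_ge (m : ℕ) (hm : 1 ≤ m) : ∃ T : List ℕ, IsText 2 T ∧
    T.length = 2 ^ (m + 1) + m + 1 ∧ 2 ^ m - 1 ≤ bwtRuns T := by
  obtain ⟨s, hs⟩ := exists_shift_register (m + 1) (by omega)
  -- Long enough to hold the window of length `m + 1` at every `j < 2 ^ (m + 1)`; the symbols are
  -- shifted by one to keep `0` for the terminator.
  set N := 2 ^ (m + 1) + m with hN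
  set T : List ℕ := (List.range N).map (fun i => (s i).val + 1) ++ [0] with hT
  have hlen : T.length = N + 1 := by simp [hT]
  have hsym : ∀ i < N, sym T i = (s i).val + 1 := by
    intro i hi
    rw [sym, hT, List.getD_append _ _ _ _ (by simpa using hi),
      List.getD_eq_getElem _ _ (by simpa using hi)]
    simp
  have htext : IsText 2 T := by
    refine ⟨_, rfl, fun c hc => ?_⟩
    obtain ⟨i, -, rfl⟩ := List.mem_map.1 hc
    have := ZMod.val_lt (s i)
    omega
  refine ⟨T, htext, hlen, ?_⟩
  set G : Finset (Fin m → ZMod 2) := Finset.univ.erase 0 with hG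
  have hGc : G.card = 2 ^ m - 1 := by
    rw [hG, Finset.card_erase_of_mem (Finset.mem_univ _)]
    simp
  -- Since `g ≠ 0`, the word `Fin.cons c g` is nonzero for both values of `c`.
  have hex : ∀ c : ZMod 2, ∀ g ∈ G, ∃ j < 2 ^ (m + 1),
      s j = c ∧ ∀ i : Fin m, s (j + 1 + i) = g i := by
    intro c g hg
    obtain ⟨j, hj, h⟩ := hs (Fin.cons c g) (fun h0 => by
      have hg0 : g ≠ 0 := (Finset.mem_erase.1 hg).1
      apply hg0
      funext i
      have := congrFun h0 i.succ
      simpa using this)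
    refine ⟨j, hj, by simpa using h 0, fun i => ?_⟩
    have := h i.succ
    rw [Fin.cons_succ, Fin.val_succ] at this
    rw [← this]
    congr 1
    omega
  have hwin : ∀ j j', j < 2 ^ (m + 1) → j' < 2 ^ (m + 1) →
      (win T m (j + 1) = win T m (j' + 1) ↔ ∀ i : Fin m, s (j + 1 + i) = s (j' + 1 + i)) := by
    intro j j' hj hj'
    rw [win_eq_iff]
    constructor
    · intro h i
      have := h i i.2
      rw [hsym _ (by omega), hsym _ (by omega)] at this
      exact ZMod.val_injective 2 (by omega)
    · intro h i hi
      rw [hsym _ (by omega), hsym _ (by omega)]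
      have := h ⟨i, hi⟩
      dsimp only at this
      rw [this]
  choose! p hp1 hp2 hp3 using hex 0
  choose! q hq1 hq2 hq3 using hex 1
  rw [← hGc]
  refine card_le_bwtRuns hm G p q (fun g hg => ?_) (fun g hg => ?_) (fun g hg => ?_)
    (fun g hg => ?_) (fun g hg g' hg' h => ?_)
  · have := hp1 g hg
    omega
  · have := hq1 g hg
    omega
  · rw [hwin _ _ (hp1 g hg) (hq1 g hg)]
    intro i
    rw [hp3 g hg, hq3 g hg]
  · have h1 := hp1 g hg
    have h2 := hq1 g hg
    rw [hsym _ (by omega), hsym _ (by omega), hp2 g hg, hq2 g hg]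
    decide
  · rw [hwin _ _ (hp1 g hg) (hp1 g' hg')] at h
    funext i
    rw [← hp3 g hg, ← hp3 g' hg', h i]

theorem exists_family_bwtRuns_ge : ∃ c : ℝ, 0 < c ∧ ∃ T : ℕ → List ℕ,
    (∀ i, IsText 2 (T i)) ∧ StrictMono (fun i => (T i).length) ∧
      ∀ i, c * ((lexSize (T i) : ℝ) * Real.logb 2 ((T i).length : ℝ)) ≤ (bwtRuns (T i) : ℝ) := by
  choose T hT hlen hr using fun i : ℕ => exists_text_bwtRuns_ge (i + 1) (by omega)
  -- `80 = 8 * 10`, from `n ≤ 8 * r` and `v * log₂ n ≤ 10 * n`.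
  refine ⟨1 / 80, by norm_num, T, hT, ?_, fun i => ?_⟩
  · refine strictMono_nat_of_lt_succ fun i => ?_
    rw [hlen, hlen]
    have : 2 ^ (i + 1 + 1) ≤ 2 ^ (i + 1 + 1 + 1) := Nat.pow_le_pow_right (by norm_num) (by omega)
    omega
  · have h1 : (T i).length ≤ 8 * bwtRuns (T i) := by
      have h2 := hr i
      have h3 : i + 1 < 2 ^ (i + 1) := Nat.lt_two_pow_self
      rw [hlen, pow_succ]
      omega
    have h1' : ((T i).length : ℝ) ≤ 8 * bwtRuns (T i) := by exact_mod_cast h1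
    have hn : 2 ≤ (T i).length := by
      have := Nat.one_le_two_pow (n := i + 1 + 1)
      rw [hlen]
      omega
    have hn' : (2 : ℝ) ≤ (T i).length := by exact_mod_cast hn
    have h4 := (hT i).lexSize_le_div_logb le_rfl hn
    have hl0 : 0 < Real.logb 2 (T i).length := Real.logb_pos (by norm_num) (by linarith)
    push_cast at h4
    rw [← mul_div_assoc, le_div_iff₀ hl0] at h4
    linarith

end LexParse

theorem theorem14 :
    -- the lex-parse is a lexicographic parse, and no lexicographic parse has fewer phrases
    (∀ (σ : ℕ) (T : List ℕ), LexParse.IsText σ T →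
      LexParse.IsLexicographicParse T (LexParse.lexParse T) ∧
      ∀ ps : List LexParse.Phrase, LexParse.IsLexicographicParse T ps →
        (LexParse.lexParse T).length ≤ ps.length) ∧
    -- `v ≤ 2 r`
    (∀ (σ : ℕ) (T : List ℕ), LexParse.IsText σ T →
      LexParse.lexSize T ≤ 2 * LexParse.bwtRuns T) ∧
    -- `v ≤ |lcpcomp|`, for every threshold and every way to break ties
    (∀ (σ : ℕ) (T : List ℕ), LexParse.IsText σ T →
      ∀ (t : ℕ) (out : List LexParse.Phrase), 1 ≤ t → LexParse.IsLcpcomp T t out →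
        LexParse.lexSize T ≤ LexParse.lcpcompSize T out) ∧
    -- `v = O(b log (n / b))`, where the logarithm stands for `1 + log₂ (n / b)`
    (∃ C : ℝ, 0 < C ∧ ∀ (σ : ℕ) (T : List ℕ), LexParse.IsText σ T →
      (LexParse.lexSize T : ℝ) ≤
        C * ((LexParse.bidirectionalSize T : ℝ) *
          (1 + Real.logb 2 ((T.length : ℝ) / (LexParse.bidirectionalSize T : ℝ))))) ∧
    -- `v log₂ n ≤ n H_k + o(n log₂ σ)` if `log_σ n → ∞` and `k = o(log_σ n)`, uniformly
    (∀ ε : ℝ, 0 < ε → ∃ δ : ℝ, 0 < δ ∧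
      ∀ (σ : ℕ) (T : List ℕ) (k : ℕ), 2 ≤ σ → LexParse.IsText σ T →
        1 ≤ δ * Real.logb (σ : ℝ) (T.length : ℝ) →
        (k : ℝ) ≤ δ * Real.logb (σ : ℝ) (T.length : ℝ) →
        (LexParse.lexSize T : ℝ) * Real.logb 2 (T.length : ℝ) ≤
          (T.length : ℝ) * LexParse.entropy T k +
            ε * ((T.length : ℝ) * Real.logb 2 (σ : ℝ))) ∧
    -- `v = O(n / log_σ n)`
    (∃ C : ℝ, 0 < C ∧ ∀ (σ : ℕ) (T : List ℕ), 2 ≤ σ → LexParse.IsText σ T → 2 ≤ T.length →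
      (LexParse.lexSize T : ℝ) ≤
        C * ((T.length : ℝ) / Real.logb (σ : ℝ) (T.length : ℝ))) ∧
    -- there is an infinite family of (binary) texts with `r = Ω(v log n)`
    (∃ c : ℝ, 0 < c ∧ ∃ T : ℕ → List ℕ,
      (∀ i, LexParse.IsText 2 (T i)) ∧ StrictMono (fun i => (T i).length) ∧
      ∀ i, c * ((LexParse.lexSize (T i) : ℝ) * Real.logb 2 ((T i).length : ℝ)) ≤
        (LexParse.bwtRuns (T i) : ℝ)) := by
  refine ⟨fun σ T hT => ⟨LexParse.lexParse_isLexicographicParse T, fun ps hps =>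
      LexParse.lexSize_le_of_isLexicographicParse hps⟩,
    fun σ T hT => LexParse.lexSize_le_two_mul_bwtRuns hT,
    fun σ T _ t out ht h => LexParse.lexSize_le_lcpcompSize ht h,
    ⟨6, by norm_num, fun σ T hT => hT.lexSize_le_bidirectionalSize⟩,
    fun ε hε => LexParse.IsText.lexSize_mul_logb_le hε,
    ⟨10, by norm_num, fun σ T hσ hT hn => hT.lexSize_le_div_logb hσ hn⟩,
    LexParse.exists_family_bwtRuns_ge⟩
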